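/- **Theorem 2.2 (Well-posedness).** Let $N\in\mathbb N$, let $B_r$ be the open Euclidean ball of radius $r$ centred at $0$ in $\mathbb R^N$, $B_r(x)$ the one centred at $x$, and $B=B_1$. Let $\lambda>0$, and let $(\nu_\xi)_{\xi\in\mathbb R^N}$ be a family of Lévy measures on $\mathbb R^N$, i.e. positive Borel measures with $\nu_\xi(\{0\})=0$ and $\int\min(1,|z|^2)\,\nu_\xi(dz)<\infty$, such that: - (M1) there is $C_\nu>0$ with $\sup_\xi\int_{\mathbb R^N}\min(1,|z|^2)\,\nu_\xi(dz)\le C_\nu$; - (M2) $\sup_\xi\nu_\xi(\mathbb R^N\setminus B_R)\to0$ as $R\to\infty$; - (M3) for all $0<r<R$ there is a modulus of continuity $\omega_{R,r}$ with $|\nu_x-\nu_y|(B_R\setminus B_r)\le\omega_{R,r}(|x-y|)$ for all $x,y\in\mathbb R^N$; - (M4) there are $r_0\in(0,1)$ and a function $g\ge0$ with $g(r)\to0$ as $r\searrow0$ such that $W_2(\nu_x,\nu_y)(B_r)\le g(r)\,|x-y|^{1/2}$ for all $0<r<r_0$ and all $x,y\in\mathbb R^N$. Here a modulus of continuity is a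 function $\omega:[0,\infty)\to[0,\infty)$ with $\omega(0)=0$ and $\omega(s)\to0$ as $s\to0$; $|\nu_1-\nu_2|(A)=\sup_{E\subseteq A}(\nu_1(E)-\nu_2(E))+\sup_{E\subseteq A}(\nu_2(E)-\nu_1(E))$ (with $E$ measurable) is the total variation; and $$W_2(\nu_1,\nu_2)(B_r)=\Big(\inf_\gamma\int_{B_r\times B_r}|z_1-z_2|^2\,d\gamma(z_1,z_2)\Big)^{1/2},$$ where $\gamma$ ranges over the positive measures on $B_r\times B_r$ with $\gamma(\{(0,0)\})=0$ whose two marginals, restricted to $B_r\setminus\{0\}$, are the restrictions of $\nu_1$ and $\nu_2$ to $B_r$. Let $m>1$ and let $H:\mathbb R^N\times\mathbb R^N\to\mathbb R$ satisfy: - (H0) $H$ is continuous and $\sup_{x}|H(x,0)|<\infty$; - (H1) there are moduli of continuity $\omega^1_H,\omega^2_H$ such that for all $x,y,p,q\in\mathbb R^N$ with $|q|\le1$, $$H(y,p+q)-H(x,p)\le\omega^1_H(|x-y|)(1+|p|^m)+\omega^2_H(|q|)(1+|p|^{m-1});$$ - (H2) there are $b_m,b_0,r_0>0$ and $\mu_0\in(0,1)$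 such that for all $\mu\in[\mu_0,1]$ and all $x,p\in\mathbb R^N$ with $|p|\ge r_0$, $$\mu H(x,\mu^{-1}p)-H(x,p)\ge(1-\mu)(b_m|p|^m-b_0).$$ Then there exists a unique bounded continuous viscosity solution $u:\mathbb R^N\to\mathbb R$ of $$\lambda u-\mathcal I_xu(x)+H(x,Du)=0\quad\text{in }\mathbb R^N,$$ where $\mathcal I_\xi u(x)=\int_{\mathbb R^N}\big(u(x+z)-u(x)-\mathbf 1_B(z)\,Du(x)\cdot z\big)\,\nu_\xi(dz)$. Viscosity solutions are understood as follows. For measurable $A$ set $\mathcal I[A](x,p,\phi)=\int_A(\phi(x+z)-\phi(x)-\mathbf 1_B(z)\,p\cdot z)\,\nu_x(dz)$. A bounded upper (resp. lower) semicontinuous $u$ is a viscosity subsolution (resp. supersolution) if, for every $\bar x\in\mathbb R^N$, every $\delta>0$ and every bounded $\phi:\mathbb R^N\to\mathbb R$ of class $C^2$ on $B_\delta(\bar x)$ such that $u-\phi$ attains its maximum (resp. minimum) over $B_\delta(\bar x)$ at $\bar x$, $$\lambda u(\bar x)-\mathcal I[B_\delta](\bar x,D\phi(\bar x),\phi)-\mathcal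 I[\mathbb R^N\setminus B_\delta](\bar x,D\phi(\bar x),u)+H(\bar x,D\phi(\bar x))\le0\quad(\text{resp. }\ge0).$$ A viscosity solution is a bounded continuous function that is both a subsolution and a supersolution. -/

import Mathlib

open MeasureTheory Filter Topology Metric
open scoped NNReal ENNReal

namespace NonlocalHJ

/-- The Euclidean space `ℝ^N`. -/
abbrev Space (N : ℕ) : Type := EuclideanSpace ℝ (Fin N)

/-- A function on `ℝ^N` that is bounded everywhere. -/
def IsBddFun {N : ℕ} (f : Space N → ℝ) : Prop :=
  ∃ C : ℝ, ∀ x, |f x| ≤ C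

/-- A modulus of continuity: `ω(s) → 0` as `s → 0`; in particular `ω(0) = 0`. -/
def IsModulus (ω : ℝ≥0 → ℝ≥0) : Prop :=
  Tendsto ω (𝓝 0) (𝓝 0)

/-! ### Lévy measures and distances between them -/

/-- Lévy measures on `ℝ^N`: no mass at the origin and `∫ min(1,|z|²) dν < ∞`. -/
def IsLevyMeasure {N : ℕ} (ν : Measure (Space N)) : Prop :=
  ν {0} = 0 ∧ ∫⁻ z, ENNReal.ofReal (min 1 (‖z‖ ^ 2)) ∂ν < ∞

/-- `(ν₁ - ν₂)⁺(A) = sup {ν₁(E) - ν₂(E) : E ⊆ A measurable}`. The supremum is nonnegative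
(take `E = ∅`), so that truncated subtraction does not change it; `A` will be a set on which
both measures are finite. -/
noncomputable def posVariation {N : ℕ} (ν₁ ν₂ : Measure (Space N)) (A : Set (Space N)) : ℝ≥0∞ :=
  ⨆ (E : Set (Space N)) (_ : MeasurableSet E) (_ : E ⊆ A), (ν₁ E - ν₂ E)

/-- The total variation `|ν₁ - ν₂|(A) = (ν₁ - ν₂)⁺(A) + (ν₁ - ν₂)⁻(A)`. -/
noncomputable def totalVar {N : ℕ} (ν₁ ν₂ : Measure (Space N)) (A : Set (Space N)) : ℝ≥0∞ :=
  posVariation ν₁ ν₂ A + posVariation ν₂ ν₁ A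

/-- Admissible couplings of two measures `ν₁, ν₂` living on `A ∋ 0`: measures on `A × A` without
mass at `(0,0)` whose marginals, restricted to `A \ {0}`, are `ν₁` and `ν₂`. -/
def Admissible {N : ℕ} (A : Set (Space N)) (ν₁ ν₂ : Measure (Space N)) :
    Set (Measure (Space N × Space N)) :=
  {γ | γ (A ×ˢ A)ᶜ = 0 ∧ γ {((0 : Space N), (0 : Space N))} = 0 ∧
    (γ.map Prod.fst).restrict (A \ {0}) = ν₁ ∧
    (γ.map Prod.snd).restrict (A \ {0}) = ν₂}

/-- The quadratic Wasserstein distance between `ν₁` and `ν₂`, restricted to the ball `B_r`. -/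
noncomputable def wasserstein2 {N : ℕ} (ν₁ ν₂ : Measure (Space N)) (r : ℝ) : ℝ≥0∞ :=
  (⨅ γ ∈ Admissible (ball (0 : Space N) r)
      (ν₁.restrict (ball 0 r)) (ν₂.restrict (ball 0 r)),
    ∫⁻ z in ball (0 : Space N) r ×ˢ ball (0 : Space N) r,
      ENNReal.ofReal (‖z.1 - z.2‖ ^ 2) ∂γ) ^ (1 / 2 : ℝ)

/-! ### Assumptions on the family of Lévy measures -/

/-- Uniform Lévy condition. -/
def AssumptionM1 {N : ℕ} (ν : Space N → Measure (Space N)) : Prop :=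
  ∃ C : ℝ, 0 < C ∧ ∀ ξ, ∫⁻ z, ENNReal.ofReal (min 1 (‖z‖ ^ 2)) ∂(ν ξ) ≤ ENNReal.ofReal C

/-- Uniform decay at infinity. -/
def AssumptionM2 {N : ℕ} (ν : Space N → Measure (Space N)) : Prop :=
  Tendsto (fun R : ℝ => ⨆ ξ, ν ξ (ball (0 : Space N) R)ᶜ) atTop (𝓝 0)

/-- Continuity in total variation away from the origin. -/
def AssumptionM3 {N : ℕ} (ν : Space N → Measure (Space N)) : Prop :=
  ∀ r R : ℝ, 0 < r → r < R → ∃ ω : ℝ≥0 → ℝ≥0, IsModulus ω ∧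
    ∀ x y, totalVar (ν x) (ν y) (ball 0 R \ ball 0 r) ≤ (ω ‖x - y‖₊ : ℝ≥0∞)

/-- Local `1/2`-Hölder continuity in the Wasserstein distance, with a constant that vanishes with
the radius, uniformly in the two points. -/
def AssumptionM4 {N : ℕ} (ν : Space N → Measure (Space N)) : Prop :=
  ∃ r₀ : ℝ, 0 < r₀ ∧ r₀ < 1 ∧ ∃ g : ℝ → ℝ≥0, Tendsto g (𝓝[>] 0) (𝓝 0) ∧
    ∀ r : ℝ, 0 < r → r < r₀ → ∀ x y,
      wasserstein2 (ν x) (ν y) r ≤ ENNReal.ofReal (g r * ‖x - y‖ ^ (1 / 2 : ℝ))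

/-! ### Assumptions on the Hamiltonian -/

/-- Continuity, and boundedness of `H(·,0)`. -/
def AssumptionH0 {N : ℕ} (H : Space N → Space N → ℝ) : Prop :=
  Continuous (fun q : Space N × Space N => H q.1 q.2) ∧ IsBddFun (fun x => H x 0)

/-- Continuity of the data, with exponent `m`. -/
def AssumptionH1 {N : ℕ} (H : Space N → Space N → ℝ) (m : ℝ) : Prop :=
  ∃ ω₁ ω₂ : ℝ≥0 → ℝ≥0, IsModulus ω₁ ∧ IsModulus ω₂ ∧
    ∀ x y p q : Space N, ‖q‖ ≤ 1 →
      H y (p + q) - H x p ≤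
        ω₁ ‖x - y‖₊ * (1 + ‖p‖ ^ m) + ω₂ ‖q‖₊ * (1 + ‖p‖ ^ (m - 1))

/-- Superlinear coercivity, with exponent `m`. -/
def AssumptionH2 {N : ℕ} (H : Space N → Space N → ℝ) (m : ℝ) : Prop :=
  ∃ bₘ b₀ r₀ μ₀ : ℝ, 0 < bₘ ∧ 0 < b₀ ∧ 0 < r₀ ∧ 0 < μ₀ ∧ μ₀ < 1 ∧
    ∀ μ : ℝ, μ₀ ≤ μ → μ ≤ 1 → ∀ x p : Space N, r₀ ≤ ‖p‖ →
      (1 - μ) * (bₘ * ‖p‖ ^ m - b₀) ≤ μ * H x (μ⁻¹ • p) - H x p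

/-! ### The nonlocal operator and viscosity solutions -/

/-- `I_ξ[A](x,p,φ) = ∫_A (φ(x+z) - φ(x) - 1_B(z) p·z) ν_ξ(dz)`, where `B` is the unit ball. -/
noncomputable def levyOp {N : ℕ} (ν : Space N → Measure (Space N)) (ξ : Space N)
    (A : Set (Space N)) (x p : Space N) (φ : Space N → ℝ) : ℝ :=
  ∫ z in A, (φ (x + z) - φ x -
    (ball (0 : Space N) 1).indicator (fun w => inner ℝ p w) z) ∂(ν ξ)

/-- `λ u(x) - I[B_δ](x,φ) - I[B_δᶜ](x,Dφ(x),u) + H(x,Dφ(x))`. -/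
noncomputable def viscExpr {N : ℕ} (lam : ℝ) (ν : Space N → Measure (Space N))
    (H : Space N → Space N → ℝ) (u φ : Space N → ℝ) (x : Space N) (δ : ℝ) : ℝ :=
  lam * u x - levyOp ν x (ball 0 δ) x (gradient φ x) φ
    - levyOp ν x (ball 0 δ)ᶜ x (gradient φ x) u + H x (gradient φ x)

/-- Bounded viscosity subsolutions of `λ u - I_x u(x) + H(x,Du) = 0` in `ℝ^N`. -/
def IsViscositySubsolution {N : ℕ} (lam : ℝ) (ν : Space N → Measure (Space N))
    (H : Space N → Space N → ℝ) (u : Space N → ℝ) : Prop :=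
  UpperSemicontinuous u ∧ IsBddFun u ∧
    ∀ (φ : Space N → ℝ) (x : Space N) (δ : ℝ), 0 < δ →
      ContDiffOn ℝ 2 φ (ball x δ) → IsBddFun φ →
      (∀ y ∈ ball x δ, u y - φ y ≤ u x - φ x) →
      viscExpr lam ν H u φ x δ ≤ 0

/-- Bounded viscosity supersolutions of `λ u - I_x u(x) + H(x,Du) = 0` in `ℝ^N`. -/
def IsViscositySupersolution {N : ℕ} (lam : ℝ) (ν : Space N → Measure (Space N))
    (H : Space N → Space N → ℝ) (u : Space N → ℝ) : Prop :=
  LowerSemicontinuous u ∧ IsBddFun u ∧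
    ∀ (φ : Space N → ℝ) (x : Space N) (δ : ℝ), 0 < δ →
      ContDiffOn ℝ 2 φ (ball x δ) → IsBddFun φ →
      (∀ y ∈ ball x δ, u x - φ x ≤ u y - φ y) →
      0 ≤ viscExpr lam ν H u φ x δ

/-- Bounded continuous viscosity solutions. -/
def IsViscositySolution {N : ℕ} (lam : ℝ) (ν : Space N → Measure (Space N))
    (H : Space N → Space N → ℝ) (u : Space N → ℝ) : Prop :=
  Continuous u ∧ IsBddFun u ∧
    IsViscositySubsolution lam ν H u ∧ IsViscositySupersolution lam ν H u

end NonlocalHJ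

/-!
Convexity is replaced by the rescaling `u ↦ μ u` with `μ < 1`: by superlinearity (H2) and (H1) it
turns the Hamiltonian difference of the doubling-of-variables argument into a gain
`c (1 + |p|)`, `p = 2α(x - y)`. The nonlocal terms cost at most a small multiple of this. At a
maximum of `μ u(x) - v(y) - α |x - y|² - b ⟨x⟩` a nearly optimal coupling of the small jumps costs
`α W₂² ≤ α g(r)² |x - y| = g(r)² |p| / 2` by (M4), jumps of intermediate size are compared in total
variation by (M3), and large jumps are negligible by (M2). Letting `μ → 1` gives comparison, hence
uniqueness. For existence the largest subsolution is its own upper envelope, and its lower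
envelope is a supersolution (Perron); comparison identifies the two.
-/

namespace NonlocalHJ

variable {N : ℕ}

/-! ### Lévy measures -/

/-- The weight `min(1,|z|²)` against which Lévy measures are finite. -/
noncomputable def levyWeight {E : Type*} [NormedAddCommGroup E] (z : E) : ℝ := min 1 (‖z‖ ^ 2)

section levyWeight

variable {E : Type*} [NormedAddCommGroup E] {z : E} {s : ℝ}

lemma levyWeight_nonneg (z : E) : 0 ≤ levyWeight z := le_min zero_le_one (by positivity)

lemma levyWeight_le_one (z : E) : levyWeight z ≤ 1 := min_le_left _ _

lemma levyWeight_le_sq (z : E) : levyWeight z ≤ ‖z‖ ^ 2 := min_le_right _ _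

@[simp] lemma levyWeight_zero : levyWeight (0 : E) = 0 := by simp [levyWeight]

lemma levyWeight_of_norm_le_one (hz : ‖z‖ ≤ 1) : levyWeight z = ‖z‖ ^ 2 :=
  min_eq_right (by nlinarith [norm_nonneg z])

lemma sq_le_levyWeight (hs : 0 ≤ s) (hs1 : s ≤ 1) (hz : s ≤ ‖z‖) : s ^ 2 ≤ levyWeight z :=
  le_min (by nlinarith) (by gcongr)

lemma continuous_levyWeight : Continuous (levyWeight (E := E)) := by
  unfold levyWeight; fun_prop

end levyWeight

namespace IsLevyMeasure

variable {ν : Measure (Space N)}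

lemma integrable_levyWeight (h : IsLevyMeasure ν) : Integrable levyWeight ν := by
  refine ⟨continuous_levyWeight.aestronglyMeasurable, ?_⟩
  rw [hasFiniteIntegral_iff_ofReal (Eventually.of_forall levyWeight_nonneg)]
  exact h.2

lemma measure_compl_ball_ne_top (h : IsLevyMeasure ν) {r : ℝ} (hr : 0 < r) :
    ν (ball 0 r)ᶜ ≠ ∞ := by
  have hs : (0 : ℝ) < min r 1 ^ 2 := by positivity
  refine ((measure_mono fun z hz => ?_).trans_lt
    (h.integrable_levyWeight.measure_ge_lt_top hs)).ne
  have hz' : r ≤ ‖z‖ := by simpa using hz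
  exact sq_le_levyWeight (by positivity) (min_le_right _ _) ((min_le_left _ _).trans hz')

lemma sq_mul_measureReal_le (h : IsLevyMeasure ν) {r : ℝ} (hr : 0 < r) (hr1 : r ≤ 1)
    {A : Set (Space N)} (hA : A ⊆ (ball 0 r)ᶜ) :
    r ^ 2 * ν.real A ≤ ∫ z, levyWeight z ∂ν := by
  have hfin := h.measure_compl_ball_ne_top hr
  calc r ^ 2 * ν.real A ≤ r ^ 2 * ν.real (ball 0 r)ᶜ := by gcongr
    _ = ∫ _ in (ball 0 r)ᶜ, r ^ 2 ∂ν := by rw [setIntegral_const, smul_eq_mul, mul_comm]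
    _ ≤ ∫ z in (ball 0 r)ᶜ, levyWeight z ∂ν :=
      setIntegral_mono_on (integrableOn_const hfin) h.integrable_levyWeight.integrableOn
        measurableSet_ball.compl fun z hz => sq_le_levyWeight hr.le hr1 (by simpa using hz)
    _ ≤ ∫ z, levyWeight z ∂ν :=
      setIntegral_le_integral h.integrable_levyWeight (Eventually.of_forall levyWeight_nonneg)

lemma tendsto_setIntegral_ball (h : IsLevyMeasure ν) :
    Tendsto (fun r : ℝ => ∫ z in ball 0 r, levyWeight z ∂ν) (𝓝[>] 0) (𝓝 0) := by
  simp_rw [← integral_indicator measurableSet_ball]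
  have hzero : 𝓝 (0 : ℝ) = 𝓝 (∫ _ : Space N, (0 : ℝ) ∂ν) := by rw [integral_zero]
  rw [hzero]
  refine tendsto_integral_filter_of_dominated_convergence levyWeight
    (Eventually.of_forall fun r =>
      (continuous_levyWeight.measurable.indicator measurableSet_ball).aestronglyMeasurable)
    (Eventually.of_forall fun r => Eventually.of_forall fun z => ?_)
    h.integrable_levyWeight (Eventually.of_forall fun z => ?_)
  · rw [Real.norm_of_nonneg (Set.indicator_nonneg (fun z _ => levyWeight_nonneg z) z)]
    exact Set.indicator_le_self' (fun _ _ => levyWeight_nonneg _) z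
  · rcases eq_or_ne z 0 with rfl | hz
    · simp [Set.indicator]
    · refine tendsto_const_nhds.congr' ?_
      filter_upwards [nhdsWithin_le_nhds (gt_mem_nhds (norm_pos_iff.2 hz))] with r hr
      rw [Set.indicator_of_notMem (by simpa using hr.le)]

end IsLevyMeasure

lemma setIntegral_levyWeight_le {ν : Measure (Space N)} {A : Set (Space N)} (h : ν A ≠ ∞) :
    ∫ z in A, levyWeight z ∂ν ≤ ν.real A := by
  have := norm_setIntegral_le_of_norm_le_const (f := levyWeight) (C := 1) h.lt_top fun z _ => by
    rw [Real.norm_of_nonneg (levyWeight_nonneg z)]; exact levyWeight_le_one z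
  rw [one_mul] at this
  exact (le_abs_self _).trans this

/-- Measurable functions dominated by `C` times the Lévy weight: a class of functions that are
integrable against every Lévy measure. -/
def LevyBounded (C : ℝ) (f : Space N → ℝ) : Prop :=
  Measurable f ∧ ∀ z, |f z| ≤ C * levyWeight z

namespace LevyBounded

variable {C : ℝ} {f : Space N → ℝ}

lemma integrable (hf : LevyBounded C f) {ν : Measure (Space N)} (h : IsLevyMeasure ν) :
    Integrable f ν :=
  (h.integrable_levyWeight.const_mul C).mono' hf.1.aestronglyMeasurable
    (Eventually.of_forall hf.2)

lemma abs_le (hf : LevyBounded C f) (hC : 0 ≤ C) (z : Space N) : |f z| ≤ C :=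
  (hf.2 z).trans (mul_le_of_le_one_right hC (levyWeight_le_one z))

lemma abs_setIntegral_le (hf : LevyBounded C f) {ν : Measure (Space N)} (h : IsLevyMeasure ν)
    (A : Set (Space N)) : |∫ z in A, f z ∂ν| ≤ C * ∫ z in A, levyWeight z ∂ν := by
  rw [← integral_const_mul, ← Real.norm_eq_abs]
  exact norm_integral_le_of_norm_le (h.integrable_levyWeight.const_mul C).integrableOn
    (Eventually.of_forall hf.2)

end LevyBounded

lemma integral_eq_ball_add_annulus_add_compl {ν : Measure (Space N)} {f : Space N → ℝ}
    (hf : Integrable f ν) {r R : ℝ} (hrR : r ≤ R) :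
    ∫ z, f z ∂ν = ∫ z in ball 0 r, f z ∂ν + ∫ z in ball 0 R \ ball 0 r, f z ∂ν +
      ∫ z in (ball 0 R)ᶜ, f z ∂ν := by
  rw [← integral_add_compl (measurableSet_ball (x := (0 : Space N)) (ε := R)) hf,
    ← setIntegral_union Set.disjoint_sdiff_right (measurableSet_ball.diff measurableSet_ball)
      hf.integrableOn hf.integrableOn, Set.union_sdiff_cancel (ball_subset_ball hrR)]

/-! ### Total variation -/

section totalVar

variable {ν₁ ν₂ : Measure (Space N)} {A : Set (Space N)} {f : Space N → ℝ} {K τ : ℝ}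

lemma lintegral_le_add_posVariation (hA : MeasurableSet A) (hf : Measurable f)
    (h0 : ∀ z, 0 ≤ f z) (hK : ∀ z ∈ A, f z ≤ K) :
    ∫⁻ z in A, ENNReal.ofReal (f z) ∂ν₁ ≤
      ∫⁻ z in A, ENNReal.ofReal (f z) ∂ν₂ + ENNReal.ofReal K * posVariation ν₁ ν₂ A := by
  have hlevel : ∀ t : ℝ, (ν₁.restrict A) {a | t < f a} ≤ (ν₂.restrict A) {a | t < f a} +
      (Set.Iio K).indicator (fun _ => posVariation ν₁ ν₂ A) t := by
    intro t
    have hm : MeasurableSet {a | t < f a} := measurableSet_lt measurable_const hf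
    rw [Measure.restrict_apply hm, Measure.restrict_apply hm]
    rcases lt_or_ge t K with ht | ht
    · rw [Set.indicator_of_mem (Set.mem_Iio.2 ht), add_comm, ← tsub_le_iff_right]
      exact le_iSup₂_of_le _ (hm.inter hA) (le_iSup_of_le Set.inter_subset_right le_rfl)
    · have : {a | t < f a} ∩ A = ∅ :=
        Set.eq_empty_of_forall_notMem fun a ha => ((hK a ha.2).trans ht).not_gt ha.1
      simp [this]
  calc ∫⁻ z in A, ENNReal.ofReal (f z) ∂ν₁
      = ∫⁻ t in Set.Ioi (0 : ℝ), (ν₁.restrict A) {a | t < f a} :=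
        lintegral_eq_lintegral_meas_lt _ (Eventually.of_forall h0) hf.aemeasurable
    _ ≤ ∫⁻ t in Set.Ioi (0 : ℝ), ((ν₂.restrict A) {a | t < f a} +
        (Set.Iio K).indicator (fun _ => posVariation ν₁ ν₂ A) t) :=
        lintegral_mono fun t => hlevel t
    _ = _ := by
      rw [lintegral_add_right _ (measurable_const.indicator measurableSet_Iio),
        lintegral_indicator_const measurableSet_Iio, Measure.restrict_apply measurableSet_Iio,
        Set.Iio_inter_Ioi, Real.volume_Ioo, sub_zero, mul_comm,
        lintegral_eq_lintegral_meas_lt _ (Eventually.of_forall h0) hf.aemeasurable]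

lemma integrableOn_of_abs_le (hA : MeasurableSet A) (h : ν₁ A ≠ ∞) (hf : Measurable f)
    (hK : ∀ z ∈ A, |f z| ≤ K) : IntegrableOn f A ν₁ :=
  IntegrableOn.of_bound h.lt_top hf.aestronglyMeasurable K
    ((ae_restrict_iff' hA).2 (Eventually.of_forall hK))

lemma setIntegral_le_add_posVariation (hA : MeasurableSet A) (h₁ : ν₁ A ≠ ∞) (h₂ : ν₂ A ≠ ∞)
    (hV : posVariation ν₁ ν₂ A ≠ ∞) (hf : Measurable f) (h0 : ∀ z, 0 ≤ f z) (hK0 : 0 ≤ K)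
    (hK : ∀ z ∈ A, f z ≤ K) :
    ∫ z in A, f z ∂ν₁ ≤ ∫ z in A, f z ∂ν₂ + K * (posVariation ν₁ ν₂ A).toReal := by
  have habs : ∀ z ∈ A, |f z| ≤ K := fun z hz => (abs_of_nonneg (h0 z)).trans_le (hK z hz)
  have hnn : 0 ≤ ∫ z in A, f z ∂ν₂ := integral_nonneg h0
  have := lintegral_le_add_posVariation (ν₁ := ν₁) (ν₂ := ν₂) hA hf h0 hK
  rw [← ofReal_integral_eq_lintegral_ofReal (integrableOn_of_abs_le hA h₁ hf habs)
      (Eventually.of_forall h0),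
    ← ofReal_integral_eq_lintegral_ofReal (integrableOn_of_abs_le hA h₂ hf habs)
      (Eventually.of_forall h0),
    ← ENNReal.ofReal_toReal hV, ← ENNReal.ofReal_mul hK0,
    ← ENNReal.ofReal_add hnn (by positivity)] at this
  exact (ENNReal.ofReal_le_ofReal_iff (by positivity)).1 this

lemma setIntegral_sub_le_totalVar (hA : MeasurableSet A) (h₁ : ν₁ A ≠ ∞) (h₂ : ν₂ A ≠ ∞)
    (hf : Measurable f) (hK0 : 0 ≤ K) (hτ0 : 0 ≤ τ) (hK : ∀ z ∈ A, |f z| ≤ K)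
    (hτ : totalVar ν₁ ν₂ A ≤ ENNReal.ofReal τ) :
    ∫ z in A, f z ∂ν₁ - ∫ z in A, f z ∂ν₂ ≤ K * τ := by
  have hV₁ : posVariation ν₁ ν₂ A ≠ ∞ :=
    ((le_self_add.trans hτ).trans_lt ENNReal.ofReal_lt_top).ne
  have hV₂ : posVariation ν₂ ν₁ A ≠ ∞ :=
    ((le_add_self.trans hτ).trans_lt ENNReal.ofReal_lt_top).ne
  have hpos := setIntegral_le_add_posVariation hA h₁ h₂ hV₁ (hf.max measurable_const)
    (fun z => le_max_right (f z) 0) hK0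
    fun z hz => max_le ((le_abs_self _).trans (hK z hz)) hK0
  have hneg := setIntegral_le_add_posVariation hA h₂ h₁ hV₂ (hf.fun_neg.max measurable_const)
    (fun z => le_max_right (-f z) 0) hK0
    fun z hz => max_le ((neg_le_abs _).trans (hK z hz)) hK0
  have hV : (posVariation ν₁ ν₂ A).toReal + (posVariation ν₂ ν₁ A).toReal ≤ τ := by
    rw [← ENNReal.toReal_add hV₁ hV₂]
    exact ENNReal.toReal_le_of_le_ofReal hτ0 hτ
  rw [integral_eq_integral_pos_part_sub_integral_neg_part (integrableOn_of_abs_le hA h₁ hf hK),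
    integral_eq_integral_pos_part_sub_integral_neg_part (integrableOn_of_abs_le hA h₂ hf hK)]
  simp only [Real.coe_toNNReal'] at *
  nlinarith [mul_le_mul_of_nonneg_left hV hK0]

end totalVar

/-! ### Couplings -/

namespace Admissible

variable {A : Set (Space N)} {ν₁ ν₂ : Measure (Space N)} {γ : Measure (Space N × Space N)}
  {f g : Space N → ℝ}

lemma ae_mem (h : γ ∈ Admissible A ν₁ ν₂) : ∀ᵐ z ∂γ, z ∈ A ×ˢ A := h.1

lemma swap (hA : MeasurableSet A) (h : γ ∈ Admissible A ν₁ ν₂) :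
    γ.map Prod.swap ∈ Admissible A ν₂ ν₁ := by
  refine ⟨?_, ?_, ?_, ?_⟩
  · rw [Measure.map_apply measurable_swap (hA.prod hA).compl, Set.preimage_compl,
      Set.preimage_swap_prod]
    exact h.1
  · rw [Measure.map_apply measurable_swap (measurableSet_singleton _)]
    convert h.2.1 using 2
    ext ⟨a, b⟩
    simp only [Set.mem_preimage, Set.mem_singleton_iff, Prod.swap_prod_mk, Prod.mk.injEq, and_comm]
  · rw [Measure.map_map measurable_fst measurable_swap]
    exact h.2.2.2
  · rw [Measure.map_map measurable_snd measurable_swap]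
    exact h.2.2.1

-- The marginals are only prescribed off the origin, which is why `f 0 = 0` is required.
lemma integrable_fst (h : γ ∈ Admissible A ν₁ ν₂) (hA : MeasurableSet A) (hf : Measurable f)
    (h0 : f 0 = 0) (hi : Integrable f ν₁) :
    Integrable (fun z => f z.1) γ ∧ ∫ z, f z.1 ∂γ = ∫ z, f z ∂ν₁ := by
  have hoff : ∀ᵐ z ∂γ, z ∉ Prod.fst ⁻¹' (A \ {0}) → f z.1 = 0 := by
    filter_upwards [ae_mem h] with z hz hz'
    by_cases hz0 : z.1 = 0
    · rw [hz0, h0]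
    · exact absurd ⟨hz.1, hz0⟩ hz'
  rw [← h.2.2.1, Measure.restrict_map measurable_fst (hA.diff (measurableSet_singleton 0))] at hi ⊢
  have hon : IntegrableOn (fun z => f z.1) (Prod.fst ⁻¹' (A \ {0})) γ :=
    (integrable_map_measure hf.aestronglyMeasurable measurable_fst.aemeasurable).1 hi
  rw [integral_map measurable_fst.aemeasurable hf.aestronglyMeasurable]
  exact ⟨hon.integrable_of_ae_notMem_eq_zero hoff,
    (setIntegral_eq_integral_of_ae_compl_eq_zero hoff).symm⟩

lemma integrable_snd (h : γ ∈ Admissible A ν₁ ν₂) (hA : MeasurableSet A) (hf : Measurable f)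
    (h0 : f 0 = 0) (hi : Integrable f ν₂) :
    Integrable (fun z => f z.2) γ ∧ ∫ z, f z.2 ∂γ = ∫ z, f z ∂ν₂ := by
  obtain ⟨h1, h2⟩ := integrable_fst (swap hA h) hA hf h0 hi
  have hm : Measurable fun z : Space N × Space N => f z.1 := hf.comp measurable_fst
  rw [integrable_map_measure hm.aestronglyMeasurable measurable_swap.aemeasurable] at h1
  rw [integral_map measurable_swap.aemeasurable hm.aestronglyMeasurable] at h2
  exact ⟨h1, h2⟩

lemma integral_sub_integral_le (h : γ ∈ Admissible A ν₁ ν₂) (hA : MeasurableSet A)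
    (hf : Measurable f) (hf0 : f 0 = 0) (hfi : Integrable f ν₁)
    (hg : Measurable g) (hg0 : g 0 = 0) (hgi : Integrable g ν₂)
    {c : Space N × Space N → ℝ} (hc : Integrable c γ)
    (hle : ∀ z₁ ∈ A, ∀ z₂ ∈ A, f z₁ - g z₂ ≤ c (z₁, z₂)) :
    ∫ z, f z ∂ν₁ - ∫ z, g z ∂ν₂ ≤ ∫ z, c z ∂γ := by
  obtain ⟨hif, ef⟩ := integrable_fst h hA hf hf0 hfi
  obtain ⟨hig, eg⟩ := integrable_snd h hA hg hg0 hgi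
  rw [← ef, ← eg, ← integral_sub hif hig]
  refine integral_mono_ae (hif.sub hig) hc ?_
  filter_upwards [ae_mem h] with z hz using hle z.1 hz.1 z.2 hz.2

end Admissible

lemma exists_coupling {ν₁ ν₂ : Measure (Space N)} {r c η : ℝ} (hc : 0 ≤ c) (hη : 0 < η)
    (h : wasserstein2 ν₁ ν₂ r ≤ ENNReal.ofReal c) :
    ∃ γ ∈ Admissible (ball (0 : Space N) r) (ν₁.restrict (ball 0 r)) (ν₂.restrict (ball 0 r)),
      Integrable (fun z : Space N × Space N => ‖z.1 - z.2‖ ^ 2) γ ∧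
        ∫ z, ‖z.1 - z.2‖ ^ 2 ∂γ ≤ c ^ 2 + η := by
  unfold wasserstein2 at h
  rw [one_div, ENNReal.rpow_inv_le_iff (by norm_num),
    ENNReal.ofReal_rpow_of_nonneg hc (by norm_num)] at h
  have hlt := h.trans_lt ((ENNReal.ofReal_lt_ofReal_iff (by positivity)).2
    (lt_add_of_pos_right (c ^ (2 : ℝ)) hη))
  simp only [iInf_lt_iff] at hlt
  obtain ⟨γ, hγ, hlt⟩ := hlt
  rw [Measure.restrict_eq_self_of_ae_mem (Admissible.ae_mem hγ), Real.rpow_two] at hlt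
  have hm : AEStronglyMeasurable (fun z : Space N × Space N => ‖z.1 - z.2‖ ^ 2) γ := by fun_prop
  have h0 : ∀ᵐ z : Space N × Space N ∂γ, 0 ≤ ‖z.1 - z.2‖ ^ 2 :=
    Eventually.of_forall fun z => by positivity
  refine ⟨γ, hγ, ⟨hm, ?_⟩, ?_⟩
  · rw [hasFiniteIntegral_iff_ofReal h0]
    exact hlt.trans ENNReal.ofReal_lt_top
  · rw [integral_eq_lintegral_of_nonneg_ae h0 hm]
    exact ENNReal.toReal_le_of_le_ofReal (by positivity) hlt.le

/-! ### Quantitative forms of the assumptions on the measures -/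

lemma IsModulus.exists_lt {ω : ℝ≥0 → ℝ≥0} (h : IsModulus ω) {η : ℝ} (hη : 0 < η) :
    ∃ s > 0, ∀ t : ℝ≥0, (t : ℝ) < s → (ω t : ℝ) < η := by
  have hev : ∀ᶠ t in 𝓝 (0 : ℝ≥0), ω t < η.toNNReal :=
    h.eventually (gt_mem_nhds (Real.toNNReal_pos.2 hη))
  obtain ⟨s, hs, hlt⟩ := Metric.eventually_nhds_iff.1 hev
  refine ⟨s, hs, fun t ht => ?_⟩
  have := hlt (y := t) (by simpa [NNReal.dist_eq] using ht)
  rwa [Real.lt_toNNReal_iff_coe_lt] at this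

section Assumptions

variable {ν : Space N → Measure (Space N)} {η : ℝ}

lemma AssumptionM1.exists_bound (h : AssumptionM1 ν) :
    ∃ C > 0, ∀ ξ, ∫ z, levyWeight z ∂(ν ξ) ≤ C := by
  obtain ⟨C, hC, h⟩ := h
  refine ⟨C, hC, fun ξ => ?_⟩
  rw [integral_eq_lintegral_of_nonneg_ae (Eventually.of_forall levyWeight_nonneg)
    continuous_levyWeight.aestronglyMeasurable]
  exact ENNReal.toReal_le_of_le_ofReal hC.le (h ξ)

lemma AssumptionM2.exists_radius (h : AssumptionM2 ν) (hη : 0 < η) :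
    ∃ R > 1, ∀ ξ, (ν ξ).real (ball 0 R)ᶜ ≤ η := by
  have hev : ∀ᶠ R : ℝ in atTop, ⨆ ξ, ν ξ (ball (0 : Space N) R)ᶜ < ENNReal.ofReal η :=
    h.eventually (gt_mem_nhds (ENNReal.ofReal_pos.2 hη))
  obtain ⟨R, hle, hR⟩ := (hev.and (eventually_gt_atTop 1)).exists
  exact ⟨R, hR, fun ξ => ENNReal.toReal_le_of_le_ofReal hη.le
    ((le_iSup (fun ξ => ν ξ (ball (0 : Space N) R)ᶜ) ξ).trans hle.le)⟩

lemma AssumptionM3.exists_dist (h : AssumptionM3 ν) {r R : ℝ} (hr : 0 < r) (hR : r < R)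
    (hη : 0 < η) :
    ∃ s > 0, ∀ x y, ‖x - y‖ < s →
      totalVar (ν x) (ν y) (ball 0 R \ ball 0 r) ≤ ENNReal.ofReal η := by
  obtain ⟨ω, hω, h⟩ := h r R hr hR
  obtain ⟨s, hs, hlt⟩ := hω.exists_lt hη
  refine ⟨s, hs, fun x y hxy => (h x y).trans ?_⟩
  rw [← ENNReal.ofReal_coe_nnreal]
  exact ENNReal.ofReal_le_ofReal (hlt _ (by simpa using hxy)).le

lemma AssumptionM4.exists_radius (h : AssumptionM4 ν) (hη : 0 < η) :
    ∃ ρ > 0, ρ < 1 ∧ ∀ r, 0 < r → r < ρ → ∀ x y, ∀ κ > 0,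
      ∃ γ ∈ Admissible (ball (0 : Space N) r) ((ν x).restrict (ball 0 r))
          ((ν y).restrict (ball 0 r)),
        Integrable (fun z : Space N × Space N => ‖z.1 - z.2‖ ^ 2) γ ∧
          ∫ z, ‖z.1 - z.2‖ ^ 2 ∂γ ≤ η * ‖x - y‖ + κ := by
  obtain ⟨r₀, h0, h1, g, hg, h⟩ := h
  have hg_lt : ∀ᶠ r in 𝓝[>] (0 : ℝ), g r < (√η).toNNReal :=
    hg.eventually (gt_mem_nhds (Real.toNNReal_pos.2 (Real.sqrt_pos.2 hη)))
  obtain ⟨t, ht, hIoo⟩ := mem_nhdsGT_iff_exists_Ioo_subset.1 hg_lt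
  refine ⟨min t r₀, lt_min ht h0, (min_le_right _ _).trans_lt h1, fun r hr hrt x y κ hκ => ?_⟩
  obtain ⟨γ, hγ, hi, hle⟩ := exists_coupling (by positivity) hκ
    (h r hr (hrt.trans_le (min_le_right _ _)) x y)
  refine ⟨γ, hγ, hi, hle.trans (add_le_add_left ?_ κ)⟩
  have hgr : (g r : ℝ) < √η :=
    Real.lt_toNNReal_iff_coe_lt.1 (hIoo ⟨hr, hrt.trans_le (min_le_left _ _)⟩)
  calc (g r * ‖x - y‖ ^ (1 / 2 : ℝ)) ^ 2 = (g r : ℝ) ^ 2 * ‖x - y‖ := by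
        rw [mul_pow, ← Real.sqrt_eq_rpow, Real.sq_sqrt (norm_nonneg _)]
    _ ≤ √η ^ 2 * ‖x - y‖ := by gcongr
    _ = η * ‖x - y‖ := by rw [Real.sq_sqrt hη.le]

lemma exists_setIntegral_ball_le (hν : ∀ ξ, IsLevyMeasure (ν ξ)) (hM4 : AssumptionM4 ν)
    (x : Space N) (hη : 0 < η) :
    ∃ r > 0, r < 1 ∧ ∀ᶠ y in 𝓝 x, ∫ z in ball 0 r, levyWeight z ∂(ν y) ≤ η := by
  obtain ⟨ρ, hρ, hρ1, hM4⟩ := hM4.exists_radius zero_lt_one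
  have hsmall : ∀ᶠ r in 𝓝[>] (0 : ℝ), ∫ z in ball 0 r, levyWeight z ∂(ν x) < η / 8 :=
    (hν x).tendsto_setIntegral_ball.eventually (gt_mem_nhds (by positivity))
  obtain ⟨r, hr, hr0, hrρ⟩ := (hsmall.and (Ioo_mem_nhdsGT hρ)).exists
  refine ⟨r, hr0, hrρ.trans hρ1, ?_⟩
  filter_upwards [ball_mem_nhds x (show 0 < η / 8 by positivity)] with y hy
  rw [mem_ball_iff_norm] at hy
  obtain ⟨γ, hγ, hi, hle⟩ := hM4 r hr0 hrρ y x (η / 8) (by positivity)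
  have hcomp := Admissible.integral_sub_integral_le hγ measurableSet_ball
    continuous_levyWeight.measurable levyWeight_zero (hν y).integrable_levyWeight.integrableOn
    (continuous_levyWeight.measurable.const_mul 2) (by simp)
    ((hν x).integrable_levyWeight.const_mul 2).integrableOn (hi.const_mul 2) fun z₁ _ z₂ hz₂ => by
      rw [mem_ball_zero_iff] at hz₂
      rw [levyWeight_of_norm_le_one (by linarith : ‖z₂‖ ≤ 1)]
      have htri : ‖z₁‖ ≤ ‖z₁ - z₂‖ + ‖z₂‖ := by simpa using norm_add_le (z₁ - z₂) z₂
      nlinarith [levyWeight_le_sq z₁, norm_nonneg z₁, sq_nonneg (‖z₁ - z₂‖ - ‖z₂‖)]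
  rw [integral_const_mul, integral_const_mul] at hcomp
  linarith

end Assumptions

/-! ### Semicontinuity of the integrals in the base point -/

lemma eventually_integral_le_add {ν : Space N → Measure (Space N)}
    (hν : ∀ ξ, IsLevyMeasure (ν ξ)) (hM2 : AssumptionM2 ν) (hM3 : AssumptionM3 ν)
    (hM4 : AssumptionM4 ν) (x : Space N) {C η : ℝ} (hC : 0 < C) (hη : 0 < η) :
    ∀ᶠ y in 𝓝 x, ∀ f, LevyBounded C f → ∫ z, f z ∂(ν y) ≤ ∫ z, f z ∂(ν x) + η := by
  set κ := η / (5 * C) with hκ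
  have hκ0 : 0 < κ := by positivity
  have hκC : 5 * (C * κ) = η := by rw [hκ]; field_simp
  obtain ⟨r, hr0, hr1, hr⟩ := exists_setIntegral_ball_le hν hM4 x hκ0
  obtain ⟨R, hR1, hR⟩ := hM2.exists_radius hκ0
  obtain ⟨s, hs, hTV⟩ := hM3.exists_dist hr0 (hr1.trans hR1) hκ0
  filter_upwards [hr, ball_mem_nhds x hs] with y hry hy f hf
  rw [mem_ball_iff_norm] at hy
  have hball : ∀ ξ, ∫ z in ball 0 r, levyWeight z ∂(ν ξ) ≤ κ →
      |∫ z in ball 0 r, f z ∂(ν ξ)| ≤ C * κ := fun ξ hξ =>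
    (hf.abs_setIntegral_le (hν ξ) _).trans (by gcongr)
  have htail : ∀ ξ, |∫ z in (ball 0 R)ᶜ, f z ∂(ν ξ)| ≤ C * κ := fun ξ => by
    refine (hf.abs_setIntegral_le (hν ξ) _).trans ?_
    gcongr
    exact (setIntegral_levyWeight_le
      ((hν ξ).measure_compl_ball_ne_top (by linarith))).trans (hR ξ)
  have hfin : ∀ ξ, ν ξ (ball 0 R \ ball 0 r) ≠ ∞ := fun ξ =>
    measure_ne_top_of_subset (fun z hz => hz.2) ((hν ξ).measure_compl_ball_ne_top hr0)
  have hmid := setIntegral_sub_le_totalVar (measurableSet_ball.diff measurableSet_ball) (hfin y)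
    (hfin x) hf.1 hC.le hκ0.le (fun z _ => hf.abs_le hC.le z) (hTV y x hy)
  rw [integral_eq_ball_add_annulus_add_compl (hf.integrable (hν y)) (hr1.trans hR1).le,
    integral_eq_ball_add_annulus_add_compl (hf.integrable (hν x)) (hr1.trans hR1).le]
  linarith [le_of_abs_le (hball y hry), neg_le_of_abs_le (hball x hr.self_of_nhds),
    le_of_abs_le (htail y), neg_le_of_abs_le (htail x)]

lemma IsLevyMeasure.eventually_integral_le {ν : Measure (Space N)} (hν : IsLevyMeasure ν)
    {ι : Type*} {l : Filter ι} [l.IsCountablyGenerated] {C : ℝ}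
    {F : ι → Space N → ℝ} {G : Space N → ℝ} (hF : ∀ᶠ i in l, LevyBounded C (F i))
    (hG : LevyBounded C G) (hFG : ∀ z, ∀ η > 0, ∀ᶠ i in l, F i z ≤ G z + η)
    {η : ℝ} (hη : 0 < η) :
    ∀ᶠ i in l, ∫ z, F i z ∂ν ≤ ∫ z, G z ∂ν + η := by
  have hexcess : Tendsto (fun i => ∫ z, max (F i z - G z) 0 ∂ν) l (𝓝 (∫ _, 0 ∂ν)) := by
    refine tendsto_integral_filter_of_dominated_convergence (fun z => 2 * C * levyWeight z)
      ?_ ?_ (hν.integrable_levyWeight.const_mul _) (Eventually.of_forall fun z => ?_)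
    · filter_upwards [hF] with i hi
      exact ((hi.1.sub hG.1).max measurable_const).aestronglyMeasurable
    · filter_upwards [hF] with i hi
      refine Eventually.of_forall fun z => ?_
      have hFz := abs_le.1 (hi.2 z)
      have hGz := abs_le.1 (hG.2 z)
      rw [Real.norm_of_nonneg (le_max_right _ _)]
      exact max_le (by linarith) (by linarith)
    · refine Metric.tendsto_nhds.2 fun e he => ?_
      filter_upwards [hFG z (e / 2) (by positivity)] with i hi
      rw [Real.dist_eq, sub_zero, abs_of_nonneg (le_max_right _ _)]
      exact max_lt (by linarith) he
  rw [integral_zero] at hexcess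
  filter_upwards [hF, hexcess.eventually (gt_mem_nhds hη)] with i hi hlt
  have hFi := hi.integrable hν
  have hGi := hG.integrable hν
  calc ∫ z, F i z ∂ν ≤ ∫ z, (G z + max (F i z - G z) 0) ∂ν :=
        integral_mono hFi (hGi.add (hFi.sub hGi).pos_part) fun z => by
          linarith [le_max_left (F i z - G z) 0]
    _ = ∫ z, G z ∂ν + ∫ z, max (F i z - G z) 0 ∂ν :=
        integral_add hGi (hFi.sub hGi).pos_part
    _ ≤ ∫ z, G z ∂ν + η := by gcongr

lemma eventually_integral_le {ν : Space N → Measure (Space N)} (hν : ∀ ξ, IsLevyMeasure (ν ξ))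
    (hM2 : AssumptionM2 ν) (hM3 : AssumptionM3 ν) (hM4 : AssumptionM4 ν)
    {ι : Type*} {l : Filter ι} [l.IsCountablyGenerated] {y : ι → Space N} {x : Space N}
    (hy : Tendsto y l (𝓝 x)) {C : ℝ} (hC : 0 < C) {F : ι → Space N → ℝ} {G : Space N → ℝ}
    (hF : ∀ᶠ i in l, LevyBounded C (F i)) (hG : LevyBounded C G)
    (hFG : ∀ z, ∀ η > 0, ∀ᶠ i in l, F i z ≤ G z + η) {η : ℝ} (hη : 0 < η) :
    ∀ᶠ i in l, ∫ z, F i z ∂(ν (y i)) ≤ ∫ z, G z ∂(ν x) + η := by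
  filter_upwards [hF, (hν x).eventually_integral_le hF hG hFG (half_pos hη),
    hy.eventually (eventually_integral_le_add hν hM2 hM3 hM4 x hC (half_pos hη))] with i hi h₁ h₂
  linarith [h₂ _ hi]

/-! ### Gradients and second-order bounds -/

section Gradient

variable {E : Type*} [NormedAddCommGroup E] [InnerProductSpace ℝ E] [CompleteSpace E]
  {f g : E → ℝ} {p q x : E}

lemma hasGradientAt_add (hf : HasGradientAt f p x) (hg : HasGradientAt g q x) :
    HasGradientAt (fun y => f y + g y) (p + q) x := by
  rw [hasGradientAt_iff_hasFDerivAt] at *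
  exact (hf.add hg).congr_fderiv (map_add _ _ _).symm

lemma hasGradientAt_const_mul (c : ℝ) (hf : HasGradientAt f p x) :
    HasGradientAt (fun y => c * f y) (c • p) x := by
  rw [hasGradientAt_iff_hasFDerivAt] at *
  refine (hf.const_mul c).congr_fderiv ?_
  ext v
  simp

lemma hasGradientAt_norm_sub_sq (c x : E) :
    HasGradientAt (fun y => ‖y - c‖ ^ 2) ((2 : ℝ) • (x - c)) x := by
  rw [hasGradientAt_iff_hasFDerivAt]
  refine ((hasFDerivAt_id x).sub_const c).norm_sq.congr_fderiv ?_
  ext v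
  simp

lemma gradient_add_const (f : E → ℝ) (c : ℝ) (x : E) :
    gradient (fun y => f y + c) x = gradient f x := by
  rw [gradient, gradient, fderiv_add_const]

lemma gradient_neg (f : E → ℝ) (x : E) : gradient (fun y => -f y) x = -gradient f x := by
  rw [gradient, gradient, fderiv_fun_neg, map_neg]

lemma gradient_add_mul_sq (hf : DifferentiableAt ℝ f x) (η : ℝ) :
    gradient (fun y => f y + η * ‖y - x‖ ^ 2) x = gradient f x := by
  have := hasGradientAt_add hf.hasGradientAt
    (hasGradientAt_const_mul η (hasGradientAt_norm_sub_sq x x))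
  rw [this.gradient, sub_self, smul_zero, smul_zero, add_zero]

lemma gradient_eq_of_isLocalMax_sub (hf : DifferentiableAt ℝ f x) (hg : DifferentiableAt ℝ g x)
    (h : IsLocalMax (fun y => f y - g y) x) : gradient f x = gradient g x := by
  have := h.fderiv_eq_zero
  rw [fderiv_fun_sub hf hg, sub_eq_zero] at this
  rw [gradient, gradient, this]

lemma continuousAt_gradient (h : ContDiffAt ℝ 2 f x) : ContinuousAt (gradient f) x :=
  (InnerProductSpace.toDual ℝ E).symm.continuous.continuousAt.comp
    (h.fderiv_right (m := 1) (by norm_num)).continuousAt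

lemma exists_taylor_bound (h : ContDiffAt ℝ 2 f x) :
    ∃ ρ > 0, ∃ C ≥ 0, ∀ y z, y ∈ ball x ρ → y + z ∈ ball x ρ →
      |f (y + z) - f y - inner ℝ (gradient f y) z| ≤ C * ‖z‖ ^ 2 := by
  obtain ⟨K, t, ht, hK⟩ := (h.fderiv_right (m := 1) (by norm_num)).exists_lipschitzOnWith
  have hd : ∀ᶠ y in 𝓝 x, DifferentiableAt ℝ f y := by
    filter_upwards [h.eventually (by simp)] with y hy using hy.differentiableAt (by simp)
  obtain ⟨ρ, hρ, hb⟩ := Metric.mem_nhds_iff.1 (inter_mem ht hd)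
  refine ⟨ρ, hρ, K, K.2, fun y z hy hz => ?_⟩
  have hseg : segment ℝ y (y + z) ⊆ ball x ρ := (convex_ball x ρ).segment_subset hy hz
  have hlip : ∀ w ∈ segment ℝ y (y + z), ‖fderiv ℝ f w - fderiv ℝ f y‖ ≤ K * ‖z‖ := fun w hw => by
    refine (hK.norm_sub_le (hb (hseg hw)).1 (hb hy).1).trans ?_
    gcongr
    simpa using norm_sub_le_of_mem_segment hw
  have hmv := Convex.norm_image_sub_le_of_norm_hasFDerivWithin_le'
    (fun w hw => (hb (hseg hw)).2.hasFDerivAt.hasFDerivWithinAt) hlip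
    (convex_segment _ _) (left_mem_segment _ _ _) (right_mem_segment _ _ _)
  rw [Real.norm_eq_abs, add_sub_cancel_left] at hmv
  rw [inner_gradient_left]
  linarith

end Gradient

section japaneseBracket

variable {E : Type*} [NormedAddCommGroup E]

/-- The Japanese bracket `⟨x⟩ = (1 + |x|²)^{1/2}`, a smooth coercive function with bounded
derivatives; small multiples of it penalise points far away in the comparison proof. -/
noncomputable def japaneseBracket (x : E) : ℝ := √(1 + ‖x‖ ^ 2)

lemma japaneseBracket_sq (x : E) : japaneseBracket x ^ 2 = 1 + ‖x‖ ^ 2 :=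
  Real.sq_sqrt (by positivity)

lemma one_le_japaneseBracket (x : E) : 1 ≤ japaneseBracket x :=
  Real.one_le_sqrt.2 (le_add_of_nonneg_right (sq_nonneg _))

lemma norm_le_japaneseBracket (x : E) : ‖x‖ ≤ japaneseBracket x :=
  Real.le_sqrt_of_sq_le (le_add_of_nonneg_left zero_le_one)

lemma japaneseBracket_add_le (x z : E) :
    japaneseBracket (x + z) ≤ japaneseBracket x + ‖z‖ := by
  have hx := one_le_japaneseBracket x
  refine Real.sqrt_le_iff.2 ⟨by positivity, ?_⟩
  calc 1 + ‖x + z‖ ^ 2 ≤ 1 + (‖x‖ + ‖z‖) ^ 2 := by gcongr; exact norm_add_le x z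
    _ ≤ (japaneseBracket x + ‖z‖) ^ 2 := by
      nlinarith [japaneseBracket_sq x,
        mul_le_mul_of_nonneg_right (norm_le_japaneseBracket x) (norm_nonneg z)]

variable [InnerProductSpace ℝ E]

lemma contDiff_japaneseBracket {n : WithTop ℕ∞} : ContDiff ℝ n (japaneseBracket (E := E)) :=
  (contDiff_const.add (contDiff_norm_sq ℝ)).sqrt fun x =>
    (add_pos_of_pos_of_nonneg one_pos (sq_nonneg ‖x‖)).ne'

lemma hasGradientAt_japaneseBracket [CompleteSpace E] (x : E) :
    HasGradientAt japaneseBracket ((japaneseBracket x)⁻¹ • x) x := by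
  have hpos : 1 + ‖x‖ ^ 2 ≠ 0 := by positivity
  rw [hasGradientAt_iff_hasFDerivAt]
  refine (((hasFDerivAt_id x).norm_sq.const_add 1).sqrt hpos).congr_fderiv ?_
  ext v
  simp [japaneseBracket]
  ring

lemma norm_inv_japaneseBracket_smul_le (x : E) : ‖(japaneseBracket x)⁻¹ • x‖ ≤ 1 := by
  have hx := one_le_japaneseBracket x
  rw [norm_smul, Real.norm_of_nonneg (by positivity), inv_mul_le_one₀ (by positivity)]
  exact norm_le_japaneseBracket x

lemma japaneseBracket_add_sub_inner_le (x z : E) :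
    japaneseBracket (x + z) - japaneseBracket x - inner ℝ ((japaneseBracket x)⁻¹ • x) z ≤
      ‖z‖ ^ 2 := by
  have hx := one_le_japaneseBracket x
  have hsq : japaneseBracket (x + z) ^ 2 =
      japaneseBracket x ^ 2 + 2 * inner ℝ x z + ‖z‖ ^ 2 := by
    rw [japaneseBracket_sq, japaneseBracket_sq, norm_add_sq_real]
    ring
  -- Concavity of the square root: `2⟨x⟩⟨x+z⟩ ≤ ⟨x⟩² + ⟨x+z⟩²`.
  have hconc : japaneseBracket x * (japaneseBracket (x + z) - japaneseBracket x) - inner ℝ x z ≤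
      ‖z‖ ^ 2 := by
    nlinarith [sq_nonneg (japaneseBracket (x + z) - japaneseBracket x), sq_nonneg ‖z‖]
  rw [real_inner_smul_left]
  refine le_of_mul_le_mul_left ?_ (zero_lt_one.trans_le hx)
  calc japaneseBracket x * (japaneseBracket (x + z) - japaneseBracket x -
        (japaneseBracket x)⁻¹ * inner ℝ x z)
      = japaneseBracket x * (japaneseBracket (x + z) - japaneseBracket x) - inner ℝ x z := by
        field_simp
    _ ≤ ‖z‖ ^ 2 := hconc
    _ ≤ japaneseBracket x * ‖z‖ ^ 2 := le_mul_of_one_le_left (sq_nonneg _) hx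

end japaneseBracket

/-! ### The equation at a point -/

/-- The integrand of `I_x u`, with `p` in place of `Du(x)`. -/
noncomputable def levyIntegrand (u : Space N → ℝ) (x p z : Space N) : ℝ :=
  u (x + z) - u x - (ball (0 : Space N) 1).indicator (fun w => inner ℝ p w) z

/-- The left-hand side `λ u - I_x u + H(x,Du)` of the equation at `x`, with `p` in place of
`Du(x)`. -/
noncomputable def residual (lam : ℝ) (ν : Space N → Measure (Space N))
    (H : Space N → Space N → ℝ) (u : Space N → ℝ) (x p : Space N) : ℝ :=
  lam * u x - ∫ z, levyIntegrand u x p z ∂(ν x) + H x p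

/-- The function equal to `φ` on the ball of radius `s` about `x` and to `u` elsewhere. The
expression tested in the definition of viscosity solutions is the residual of such a function. -/
noncomputable def patch (u φ : Space N → ℝ) (x : Space N) (s : ℝ) (y : Space N) : ℝ :=
  if dist y x < s then φ y else u y

/-- `φ` is of class `C²` and bounded on the ball of radius `t` about `x`. -/
structure IsTestOn (φ : Space N → ℝ) (x : Space N) (t : ℝ) : Prop where
  pos : 0 < t
  contDiffOn : ContDiffOn ℝ 2 φ (ball x t)
  bdd : ∃ K, ∀ y ∈ ball x t, |φ y| ≤ K

namespace IsTestOn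

variable {φ : Space N → ℝ} {x : Space N} {s t : ℝ}

lemma of_ball_subset (h : IsTestOn φ x t) {y : Space N} (hs : 0 < s) (hsub : ball y s ⊆ ball x t) :
    IsTestOn φ y s :=
  ⟨hs, h.contDiffOn.mono hsub, h.bdd.imp fun _ hK y hy => hK y (hsub hy)⟩

lemma mono (h : IsTestOn φ x t) (hs : 0 < s) (hst : s ≤ t) : IsTestOn φ x s :=
  h.of_ball_subset hs (ball_subset_ball hst)

lemma contDiffAt (h : IsTestOn φ x t) {y : Space N} (hy : y ∈ ball x t) : ContDiffAt ℝ 2 φ y :=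
  h.contDiffOn.contDiffAt (isOpen_ball.mem_nhds hy)

lemma contDiffAt_center (h : IsTestOn φ x t) : ContDiffAt ℝ 2 φ x :=
  h.contDiffAt (mem_ball_self h.pos)

lemma differentiableAt (h : IsTestOn φ x t) : DifferentiableAt ℝ φ x :=
  h.contDiffAt_center.differentiableAt (by simp)

lemma neg (h : IsTestOn φ x t) : IsTestOn (fun y => -φ y) x t :=
  ⟨h.pos, h.contDiffOn.neg, h.bdd.imp fun _ hK y hy => (abs_neg _).trans_le (hK y hy)⟩

lemma add_const (h : IsTestOn φ x t) (c : ℝ) : IsTestOn (fun y => φ y + c) x t :=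
  ⟨h.pos, h.contDiffOn.add contDiffOn_const, h.bdd.imp' (· + |c|) fun _ hK y hy =>
    (abs_add_le _ _).trans (add_le_add_left (hK y hy) _)⟩

lemma add_sq (h : IsTestOn φ x t) (η : ℝ) : IsTestOn (fun y => φ y + η * ‖y - x‖ ^ 2) x t := by
  obtain ⟨K, hK⟩ := h.bdd
  refine ⟨h.pos, h.contDiffOn.add
    (contDiff_const.mul ((contDiff_id.sub contDiff_const).norm_sq ℝ)).contDiffOn,
    K + |η| * t ^ 2, fun y hy => (abs_add_le _ _).trans (add_le_add (hK y hy) ?_)⟩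
  rw [abs_mul, abs_of_nonneg (sq_nonneg ‖y - x‖)]
  gcongr
  exact (mem_ball_iff_norm.1 hy).le

end IsTestOn

lemma exists_isTestOn {φ : Space N → ℝ} {x : Space N} (h : ContDiffAt ℝ 2 φ x) {t : ℝ}
    (ht : 0 < t) : ∃ s, s ≤ t ∧ IsTestOn φ x s := by
  have hbdd : ∀ᶠ y in 𝓝 x, |φ y| ≤ |φ x| + 1 :=
    h.continuousAt.abs.eventually_le_const (lt_add_one _)
  obtain ⟨s, hs, hsub⟩ := Metric.mem_nhds_iff.1 ((h.eventually (by simp)).and hbdd)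
  exact ⟨min s t, min_le_right _ _, lt_min hs ht,
    fun y hy => (hsub (ball_subset_ball (min_le_left _ _) hy)).1.contDiffWithinAt,
    |φ x| + 1, fun y hy => (hsub (ball_subset_ball (min_le_left _ _) hy)).2⟩

section patch

variable {u φ : Space N → ℝ} {x y : Space N} {s : ℝ}

lemma patch_of_mem (h : y ∈ ball x s) : patch u φ x s y = φ y := if_pos h

lemma patch_of_notMem (h : y ∉ ball x s) : patch u φ x s y = u y := if_neg h

lemma patch_center (hs : 0 < s) : patch u φ x s x = φ x := patch_of_mem (mem_ball_self hs)

lemma patch_eventuallyEq (hs : 0 < s) : patch u φ x s =ᶠ[𝓝 x] φ :=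
  eventually_of_mem (ball_mem_nhds x hs) fun _ => patch_of_mem

lemma le_patch {w : Space N → ℝ} (hu : ∀ y, w y ≤ u y) (hφ : ∀ y ∈ ball x s, w y ≤ φ y)
    (y : Space N) : w y ≤ patch u φ x s y := by
  unfold patch
  split_ifs with hy
  exacts [hφ y hy, hu y]

lemma abs_patch_le {K : ℝ} (hu : ∀ y, |u y| ≤ K) (hφ : ∀ y ∈ ball x s, |φ y| ≤ K)
    (y : Space N) : |patch u φ x s y| ≤ K := by
  unfold patch
  split_ifs with hy
  exacts [hφ y hy, hu y]

lemma measurable_patch (hu : Measurable u) (hφ : ContinuousOn φ (ball x s)) :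
    Measurable (patch u φ x s) := by
  classical
  have hball : Measurable ((ball x s).piecewise φ 0) :=
    hφ.measurable_piecewise continuousOn_const measurableSet_ball
  have : patch u φ x s = (ball x s).piecewise ((ball x s).piecewise φ 0) u := by
    ext y
    by_cases hy : y ∈ ball x s
    · simp [patch_of_mem hy, hy]
    · simp [patch_of_notMem hy, hy]
  rw [this]
  exact hball.piecewise measurableSet_ball hu

end patch

section levyIntegrand

variable {u φ w : Space N → ℝ} {x p : Space N} {s t C K P : ℝ}

lemma abs_indicator_inner_le (p z : Space N) :
    |(ball (0 : Space N) 1).indicator (fun w => inner ℝ p w) z| ≤ ‖p‖ := by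
  by_cases hz : z ∈ ball (0 : Space N) 1
  · rw [Set.indicator_of_mem hz]
    rw [mem_ball_zero_iff] at hz
    exact (abs_real_inner_le_norm p z).trans (mul_le_of_le_one_right (norm_nonneg p) hz.le)
  · simp [Set.indicator_of_notMem hz]

lemma abs_levyIntegrand_le (hu : ∀ y, |u y| ≤ K) (x p z : Space N) :
    |levyIntegrand u x p z| ≤ 2 * K + ‖p‖ := by
  have := abs_indicator_inner_le p z
  have := abs_sub (u (x + z) - u x) ((ball (0 : Space N) 1).indicator (fun w => inner ℝ p w) z)
  have := abs_sub (u (x + z)) (u x)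
  unfold levyIntegrand
  linarith [hu (x + z), hu x]

lemma measurable_levyIntegrand (hu : Measurable u) : Measurable (levyIntegrand u x p) :=
  ((hu.comp (measurable_const_add x)).sub_const _).sub
    (Measurable.indicator (by fun_prop) measurableSet_ball)

@[simp] lemma levyIntegrand_zero (u : Space N → ℝ) (x p : Space N) : levyIntegrand u x p 0 = 0 := by
  simp [levyIntegrand]

lemma levyIntegrand_of_norm_lt {z : Space N} (hz : ‖z‖ < 1) :
    levyIntegrand u x p z = u (x + z) - u x - inner ℝ p z := by
  rw [levyIntegrand, Set.indicator_of_mem (by simpa using hz)]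

lemma levyIntegrand_neg (u : Space N → ℝ) (x p z : Space N) :
    levyIntegrand (-u) x (-p) z = -levyIntegrand u x p z := by
  by_cases hz : z ∈ ball (0 : Space N) 1 <;>
    simp only [levyIntegrand, Pi.neg_apply, Set.indicator_of_mem, Set.indicator_of_notMem,
      inner_neg_left, hz, not_false_eq_true] <;> ring

lemma levyIntegrand_mono (h : ∀ y, u y ≤ w y) (hx : u x = w x) (p z : Space N) :
    levyIntegrand u x p z ≤ levyIntegrand w x p z := by
  unfold levyIntegrand
  rw [hx]
  gcongr
  exact h _

lemma levyBounded_levyIntegrand (hu : Measurable u) (huK : ∀ y, |u y| ≤ K) (hp : ‖p‖ ≤ P)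
    (hs : 0 < s) (hs1 : s ≤ 1) (hC : 0 ≤ C)
    (hT : ∀ z, ‖z‖ < s → |u (x + z) - u x - inner ℝ p z| ≤ C * ‖z‖ ^ 2) :
    LevyBounded (C + (2 * K + P) / s ^ 2) (levyIntegrand u x p) := by
  refine ⟨measurable_levyIntegrand hu, fun z => ?_⟩
  have hK : 0 ≤ K := (abs_nonneg _).trans (huK x)
  have hP : 0 ≤ P := (norm_nonneg _).trans hp
  have hw := levyWeight_nonneg z
  rcases lt_or_ge ‖z‖ s with hz | hz
  · have hz1 : ‖z‖ < 1 := hz.trans_le hs1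
    rw [levyIntegrand_of_norm_lt hz1]
    calc _ ≤ C * ‖z‖ ^ 2 := hT z hz
      _ = C * levyWeight z := by rw [levyWeight_of_norm_le_one hz1.le]
      _ ≤ _ := by gcongr; exact le_add_of_nonneg_right (by positivity)
  · calc _ ≤ 2 * K + P := (abs_levyIntegrand_le huK x p z).trans (by gcongr)
      _ = (2 * K + P) / s ^ 2 * s ^ 2 := by field_simp
      _ ≤ (2 * K + P) / s ^ 2 * levyWeight z := by gcongr; exact sq_le_levyWeight hs.le hs1 hz
      _ ≤ _ := by gcongr; exact le_add_of_nonneg_left hC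

lemma levyBounded_levyIntegrand_patch (hu : Measurable u) (huK : ∀ y, |u y| ≤ K)
    (hφ : ContinuousOn φ (ball x t)) (hφK : ∀ y ∈ ball x t, |φ y| ≤ K) (hp : ‖p‖ ≤ P)
    (hs : 0 < s) (hs1 : s ≤ 1) (hst : s ≤ t) (hC : 0 ≤ C)
    (hT : ∀ z, ‖z‖ < s → |φ (x + z) - φ x - inner ℝ p z| ≤ C * ‖z‖ ^ 2) :
    LevyBounded (C + (2 * K + P) / s ^ 2) (levyIntegrand (patch u φ x t) x p) := by
  refine levyBounded_levyIntegrand (measurable_patch hu hφ) (abs_patch_le huK hφK) hp hs hs1 hC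
    fun z hz => ?_
  rw [patch_of_mem (show x + z ∈ ball x t by simpa using hz.trans_le hst),
    patch_center (hs.trans_le hst)]
  exact hT z hz

lemma IsTestOn.integrable_levyIntegrand_patch (hφ : IsTestOn φ x t) (hu : Measurable u)
    (hub : IsBddFun u) {ν : Measure (Space N)} (hν : IsLevyMeasure ν) :
    Integrable (levyIntegrand (patch u φ x t) x (gradient φ x)) ν := by
  obtain ⟨K₁, hK₁⟩ := hub
  obtain ⟨K₂, hK₂⟩ := hφ.bdd
  obtain ⟨ρ, hρ, C, hC, hT⟩ := exists_taylor_bound hφ.contDiffAt_center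
  have ht := hφ.pos
  refine (levyBounded_levyIntegrand_patch (K := max K₁ K₂) (s := min ρ (min 1 t)) hu
    (fun y => (hK₁ y).trans (le_max_left _ _)) hφ.contDiffOn.continuousOn
    (fun y hy => (hK₂ y hy).trans (le_max_right _ _)) le_rfl (by positivity)
    ((min_le_right _ _).trans (min_le_left _ _)) ((min_le_right _ _).trans (min_le_right _ _)) hC
    fun z hz => hT x z (mem_ball_self hρ) ?_).integrable hν
  simpa using hz.trans_le (min_le_left _ _)

end levyIntegrand

section residual

variable {lam : ℝ} {ν : Space N → Measure (Space N)} {H : Space N → Space N → ℝ}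
  {u φ w : Space N → ℝ} {x p : Space N} {t δ : ℝ}

lemma residual_anti (hu : Integrable (levyIntegrand u x p) (ν x))
    (hw : Integrable (levyIntegrand w x p) (ν x)) (h : ∀ y, u y ≤ w y) (hx : u x = w x) :
    residual lam ν H w x p ≤ residual lam ν H u x p := by
  have := integral_mono hu hw (levyIntegrand_mono h hx p)
  unfold residual
  rw [hx]
  linarith

lemma residual_neg (lam : ℝ) (ν : Space N → Measure (Space N)) (H : Space N → Space N → ℝ)
    (u : Space N → ℝ) (x p : Space N) :
    residual lam ν (fun x p => -H x (-p)) (-u) x (-p) = -residual lam ν H u x p := by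
  simp only [residual, levyIntegrand_neg, integral_neg, Pi.neg_apply, neg_neg]
  ring

lemma viscExpr_eq_residual (hν : ∀ ξ, IsLevyMeasure (ν ξ)) (hu : Measurable u)
    (hub : IsBddFun u) (hφ : IsTestOn φ x δ) (hx : φ x = u x) :
    viscExpr lam ν H u φ x δ = residual lam ν H (patch u φ x δ) x (gradient φ x) := by
  have hcenter : patch u φ x δ x = u x := (patch_center hφ.pos).trans hx
  have hin : levyOp ν x (ball 0 δ) x (gradient φ x) φ =
      ∫ z in ball 0 δ, levyIntegrand (patch u φ x δ) x (gradient φ x) z ∂(ν x) :=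
    setIntegral_congr_fun measurableSet_ball fun z hz => by
      simp only [levyIntegrand, hcenter, hx,
        patch_of_mem (show x + z ∈ ball x δ by simpa using hz)]
  have hout : levyOp ν x (ball 0 δ)ᶜ x (gradient φ x) u =
      ∫ z in (ball 0 δ)ᶜ, levyIntegrand (patch u φ x δ) x (gradient φ x) z ∂(ν x) :=
    setIntegral_congr_fun measurableSet_ball.compl fun z hz => by
      simp only [levyIntegrand, hcenter,
        patch_of_notMem (show x + z ∉ ball x δ by simpa using hz)]
  rw [viscExpr, hin, hout, residual, hcenter, ← integral_add_compl measurableSet_ball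
    (hφ.integrable_levyIntegrand_patch hu hub (hν x))]
  ring

lemma viscExpr_add_const (lam : ℝ) (ν : Space N → Measure (Space N)) (H : Space N → Space N → ℝ)
    (u φ : Space N → ℝ) (x : Space N) (δ c : ℝ) :
    viscExpr lam ν H u (fun y => φ y + c) x δ = viscExpr lam ν H u φ x δ := by
  simp only [viscExpr, levyOp, gradient_add_const, add_sub_add_right_eq_sub]

lemma viscExpr_neg (lam : ℝ) (ν : Space N → Measure (Space N)) (H : Space N → Space N → ℝ)
    (u φ : Space N → ℝ) (x : Space N) (δ : ℝ) :
    viscExpr lam ν (fun x p => -H x (-p)) (-u) (fun y => -φ y) x δ = -viscExpr lam ν H u φ x δ := by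
  have hop : ∀ (A : Set (Space N)) (v : Space N → ℝ),
      levyOp ν x A x (-gradient φ x) (-v) = -levyOp ν x A x (gradient φ x) v := fun A v => by
    rw [levyOp, levyOp, ← integral_neg]
    exact integral_congr_ae (Eventually.of_forall (levyIntegrand_neg v x _))
  have hφ : (fun y => -φ y) = -φ := rfl
  rw [viscExpr, viscExpr, gradient_neg, hφ, hop, hop, neg_neg, Pi.neg_apply]
  ring

lemma isBddFun_neg (hu : IsBddFun u) : IsBddFun (-u) :=
  hu.imp fun _ hK y => (abs_neg _).trans_le (hK y)

end residual

/-! ### Viscosity inequalities as pointwise inequalities -/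

lemma integrable_of_forall_compl_ball {ν : Measure (Space N)} (h0 : ν {0} = 0)
    {D : Space N → ℝ} (hD : ∀ z, 0 ≤ D z) {δ I : ℝ} (hδ : 0 < δ)
    (hinteg : ∀ r, 0 < r → r ≤ δ → IntegrableOn D (ball 0 r)ᶜ ν)
    (hle : ∀ r, 0 < r → r ≤ δ → ∫ z in (ball 0 r)ᶜ, D z ∂ν ≤ I) :
    Integrable D ν ∧ ∫ z, D z ∂ν ≤ I := by
  set r : ℕ → ℝ := fun n => δ / (n + 1)
  have hr0 : ∀ n, 0 < r n := fun n => by positivity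
  have hrδ : ∀ n, r n ≤ δ := fun n => div_le_self hδ.le (by simp)
  have hr : Tendsto r atTop (𝓝 0) := by
    simpa [r, div_eq_mul_inv] using (tendsto_one_div_add_atTop_nhds_zero_nat (𝕜 := ℝ)).const_mul δ
  have hcover : AECover ν atTop fun n => (ball (0 : Space N) (r n))ᶜ := by
    refine ⟨?_, fun _ => measurableSet_ball.compl⟩
    filter_upwards [measure_eq_zero_iff_ae_notMem.1 h0] with z hz
    filter_upwards [hr.eventually (gt_mem_nhds (norm_pos_iff.2 hz))] with n hn
    simpa using hn.le
  have hD_int : Integrable D ν := hcover.integrable_of_integral_bounded_of_nonneg_ae I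
    (fun n => hinteg _ (hr0 n) (hrδ n)) (Eventually.of_forall hD)
    (Eventually.of_forall fun n => hle _ (hr0 n) (hrδ n))
  exact ⟨hD_int, le_of_tendsto' (hcover.integral_tendsto_of_countably_generated hD_int)
    fun n => hle _ (hr0 n) (hrδ n)⟩

section subsolution

variable {lam : ℝ} {ν : Space N → Measure (Space N)} {H : Space N → Space N → ℝ}
  {u φ : Space N → ℝ} {x : Space N} {t : ℝ}

lemma IsViscositySubsolution.residual_patch_le (hν : ∀ ξ, IsLevyMeasure (ν ξ))
    (hu : IsViscositySubsolution lam ν H u) (hφ : IsTestOn φ x t) (hx : φ x = u x)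
    (hle : ∀ y ∈ ball x t, u y ≤ φ y) :
    residual lam ν H (patch u φ x t) x (gradient φ x) ≤ 0 := by
  obtain ⟨husc, ⟨K₁, hK₁⟩, htest⟩ := hu
  obtain ⟨K₂, hK₂⟩ := hφ.bdd
  have hcongr : Set.EqOn (patch u φ x t) φ (ball x t) := fun y => patch_of_mem
  have hψ : IsTestOn (patch u φ x t) x t :=
    ⟨hφ.pos, hφ.contDiffOn.congr hcongr, K₂, fun y hy => by rw [hcongr hy]; exact hK₂ y hy⟩
  have hpatch : patch u (patch u φ x t) x t = patch u φ x t := by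
    ext y
    by_cases hy : dist y x < t <;> simp [patch, hy]
  have hcenter : patch u φ x t x = u x := (patch_center hφ.pos).trans hx
  have hgrad : gradient (patch u φ x t) x = gradient φ x := (patch_eventuallyEq hφ.pos).gradient_eq
  have hvisc := htest (patch u φ x t) x t hφ.pos hψ.contDiffOn
    ⟨max K₁ K₂, abs_patch_le (fun y => (hK₁ y).trans (le_max_left _ _))
      fun y hy => (hK₂ y hy).trans (le_max_right _ _)⟩
    fun y hy => by
      rw [hcongr hy, hcenter, sub_self]
      exact sub_nonpos.2 (hle y hy)
  rwa [viscExpr_eq_residual hν husc.measurable ⟨K₁, hK₁⟩ hψ hcenter, hpatch, hgrad] at hvisc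

lemma indicator_compl_ball_levyIntegrand_sub {r : ℝ} (hr : 0 < r) (hrt : r ≤ t) (hx : φ x = u x)
    (p : Space N) :
    (ball 0 r)ᶜ.indicator (fun z => levyIntegrand (patch u φ x t) x p z - levyIntegrand u x p z) =
      fun z => levyIntegrand (patch u φ x t) x p z - levyIntegrand (patch u φ x r) x p z := by
  ext z
  by_cases hz : z ∈ ball 0 r
  · have hzr : x + z ∈ ball x r := by simpa using hz
    simp only [levyIntegrand, patch_center hr, patch_center (hr.trans_le hrt), patch_of_mem hzr,
      patch_of_mem (ball_subset_ball hrt hzr), sub_self,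
      Set.indicator_of_notMem (Set.notMem_compl_iff.2 hz)]
  · have hzr : x + z ∉ ball x r := by simpa using hz
    rw [Set.indicator_of_mem hz]
    simp only [levyIntegrand, patch_center hr, hx, patch_of_notMem hzr]

lemma integral_levyIntegrand_le {m : ℝ} (hν : ∀ ξ, IsLevyMeasure (ν ξ))
    (hu : Measurable u) (hub : IsBddFun u) (hφ : IsTestOn φ x t) (hx : φ x = u x)
    (hle : ∀ y ∈ ball x t, u y ≤ φ y)
    (hm : ∀ r, 0 < r → r ≤ t →
      m ≤ ∫ z, levyIntegrand (patch u φ x r) x (gradient φ x) z ∂(ν x)) :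
    Integrable (levyIntegrand u x (gradient φ x)) (ν x) ∧
      m ≤ ∫ z, levyIntegrand u x (gradient φ x) z ∂(ν x) := by
  set p := gradient φ x
  set W : ℝ → Space N → ℝ := fun r => levyIntegrand (patch u φ x r) x p
  set D : Space N → ℝ := fun z => W t z - levyIntegrand u x p z with hD
  have hW_int : ∀ r, 0 < r → r ≤ t → Integrable (W r) (ν x) := fun r hr hrt =>
    (hφ.mono hr hrt).integrable_levyIntegrand_patch hu hub (hν x)
  have hD0 : ∀ z, 0 ≤ D z := fun z => sub_nonneg.2 <|
    levyIntegrand_mono (le_patch (fun _ => le_rfl) hle) ((patch_center hφ.pos).trans hx).symm p z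
  have hindicator : ∀ r, 0 < r → r ≤ t → (ball 0 r)ᶜ.indicator D = fun z => W t z - W r z :=
    fun r hr hrt => indicator_compl_ball_levyIntegrand_sub hr hrt hx p
  obtain ⟨hD_int, hD_le⟩ := integrable_of_forall_compl_ball (hν x).1 hD0 hφ.pos
    (I := ∫ z, W t z ∂(ν x) - m)
    (fun r hr hrt => by
      rw [← integrable_indicator_iff measurableSet_ball.compl, hindicator r hr hrt]
      exact (hW_int t hφ.pos le_rfl).sub (hW_int r hr hrt))
    (fun r hr hrt => by
      rw [← integral_indicator measurableSet_ball.compl, hindicator r hr hrt,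
        integral_sub (hW_int t hφ.pos le_rfl) (hW_int r hr hrt)]
      linarith [hm r hr hrt])
  have hsub : levyIntegrand u x p = fun z => W t z - D z := by ext z; simp only [hD]; ring
  rw [hsub]
  refine ⟨(hW_int t hφ.pos le_rfl).sub hD_int, ?_⟩
  rw [integral_sub (hW_int t hφ.pos le_rfl) hD_int]
  linarith

-- The touching radius can be sent to `0` because the integrands of the patched functions decrease.
lemma IsViscositySubsolution.residual_le (hν : ∀ ξ, IsLevyMeasure (ν ξ))
    (hu : IsViscositySubsolution lam ν H u) (hφ : ContDiffAt ℝ 2 φ x)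
    (hmax : IsLocalMax (fun y => u y - φ y) x) :
    Integrable (levyIntegrand u x (gradient φ x)) (ν x) ∧
      residual lam ν H u x (gradient φ x) ≤ 0 := by
  obtain ⟨ρ, hρ, hball⟩ := Metric.eventually_nhds_iff_ball.1 hmax
  obtain ⟨t, htρ, hφt⟩ := exists_isTestOn hφ hρ
  set ψ : Space N → ℝ := fun y => φ y + (u x - φ x) with hψ
  have hgrad : gradient ψ x = gradient φ x := gradient_add_const φ _ x
  have hψx : ψ x = u x := by simp [hψ]
  have hle : ∀ y ∈ ball x t, u y ≤ ψ y := fun y hy => by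
    simp only [hψ]; linarith [hball y (ball_subset_ball htρ hy)]
  have hψt : IsTestOn ψ x t := hφt.add_const _
  have key := integral_levyIntegrand_le (m := lam * u x + H x (gradient ψ x)) hν
    hu.1.measurable hu.2.1 hψt hψx hle fun r hr hrt => by
      have := hu.residual_patch_le hν (hψt.mono hr hrt) hψx
        fun y hy => hle y (ball_subset_ball hrt hy)
      rw [residual, patch_center hr, hψx] at this
      linarith
  rw [hgrad] at key
  refine ⟨key.1, ?_⟩
  unfold residual
  linarith [key.2]

lemma residual_patch_le_add (hν : IsLevyMeasure (ν x)) (hu : Measurable u) (hub : IsBddFun u)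
    {s η : ℝ} (hη : 0 ≤ η) (hφ : IsTestOn φ x t) (hx : φ x = u x)
    (hle : ∀ y ∈ ball x t, u y ≤ φ y) (hs : 0 < s) (hst : s ≤ t) (hs1 : s ≤ 1) :
    residual lam ν H (patch u φ x t) x (gradient φ x) ≤
      residual lam ν H (patch u (fun y => φ y + η * ‖y - x‖ ^ 2) x s) x (gradient φ x) +
        η * ∫ z, levyWeight z ∂(ν x) := by
  set p := gradient φ x
  set ψ : Space N → ℝ := fun y => φ y + η * ‖y - x‖ ^ 2 with hψ
  have hψx : ψ x = u x := by simp [hψ, hx]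
  have hgrad : gradient ψ x = p := gradient_add_mul_sq hφ.differentiableAt η
  have hinteg := hφ.integrable_levyIntegrand_patch hu hub hν
  have hinteg' := ((hφ.add_sq η).mono hs hst).integrable_levyIntegrand_patch hu hub hν
  rw [hgrad] at hinteg'
  have hmono : ∀ z, levyIntegrand (patch u ψ x s) x p z ≤
      levyIntegrand (patch u φ x t) x p z + η * levyWeight z := fun z => by
    simp only [levyIntegrand, patch_center hs, patch_center (hs.trans_le hst), hψx, hx]
    by_cases hz : x + z ∈ ball x s
    · have hz1 : ‖z‖ ≤ 1 := (lt_of_lt_of_le (by simpa using hz) hs1).le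
      rw [patch_of_mem hz, patch_of_mem (ball_subset_ball hst hz), levyWeight_of_norm_le_one hz1]
      simp only [hψ, add_sub_cancel_left]
      linarith
    · have := le_patch (x := x) (s := t) (fun _ => le_rfl) hle (x + z)
      rw [patch_of_notMem hz]
      linarith [mul_nonneg hη (levyWeight_nonneg z)]
  have := integral_mono hinteg' (hinteg.add (hν.integrable_levyWeight.const_mul η)) hmono
  rw [integral_add' hinteg (hν.integrable_levyWeight.const_mul η), integral_const_mul] at this
  unfold residual
  rw [patch_center hs, patch_center hφ.pos, hψx, hx]
  linarith

lemma isViscositySubsolution_of_strict (hν : ∀ ξ, IsLevyMeasure (ν ξ))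
    (husc : UpperSemicontinuous u) (hub : IsBddFun u)
    (h : ∀ (φ : Space N → ℝ) (x : Space N) (t η : ℝ), 0 < η → IsTestOn φ x t → φ x = u x →
      (∀ y ∈ ball x t, u y + η * ‖y - x‖ ^ 2 ≤ φ y) →
      ∃ s, 0 < s ∧ s ≤ t ∧ residual lam ν H (patch u φ x s) x (gradient φ x) ≤ 0) :
    IsViscositySubsolution lam ν H u := by
  refine ⟨husc, hub, fun φ x δ hδ hφ hφb hmax => ?_⟩
  rw [← viscExpr_add_const lam ν H u φ x δ (u x - φ x)]
  set ψ : Space N → ℝ := fun y => φ y + (u x - φ x) with hψ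
  have hψδ : IsTestOn ψ x δ := IsTestOn.add_const ⟨hδ, hφ, hφb.imp fun _ hK y _ => hK y⟩ _
  have hψx : ψ x = u x := by simp [hψ]
  have hle : ∀ y ∈ ball x δ, u y ≤ ψ y := fun y hy => by
    simp only [hψ]; linarith [hmax y hy]
  have hI : 0 ≤ ∫ z, levyWeight z ∂(ν x) := integral_nonneg levyWeight_nonneg
  rw [viscExpr_eq_residual hν husc.measurable hub hψδ hψx]
  refine le_of_forall_pos_le_add fun ε hε => ?_
  set η := ε / (∫ z, levyWeight z ∂(ν x) + 1)
  have hη : 0 < η := by positivity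
  obtain ⟨s, hs, hst, hres⟩ := h (fun y => ψ y + η * ‖y - x‖ ^ 2) x (min δ 1) η hη
    ((hψδ.add_sq η).mono (by positivity) (min_le_left _ _)) (by simp [hψx])
    fun y hy => by linarith [hle y (ball_subset_ball (min_le_left _ _) hy)]
  rw [gradient_add_mul_sq hψδ.differentiableAt] at hres
  have hηI : η * ∫ z, levyWeight z ∂(ν x) ≤ ε := by
    rw [div_mul_eq_mul_div, div_le_iff₀ (by positivity)]
    nlinarith
  linarith [residual_patch_le_add (lam := lam) (H := H) (hν x) husc.measurable hub hη.le hψδ hψx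
    hle hs (hst.trans (min_le_left _ _)) (hst.trans (min_le_right _ _))]

end subsolution

lemma isViscositySupersolution_iff_neg {lam : ℝ} {ν : Space N → Measure (Space N)}
    {H : Space N → Space N → ℝ} {u : Space N → ℝ} :
    IsViscositySupersolution lam ν H u ↔
      IsViscositySubsolution lam ν (fun x p => -H x (-p)) (-u) := by
  refine and_congr ⟨fun h => h.neg, fun h => ?_⟩ (and_congr ⟨isBddFun_neg, fun h => ?_⟩
    ⟨fun h φ x δ hδ hφ hφb hmax => ?_, fun h φ x δ hδ hφ hφb hmin => ?_⟩)
  · simpa only [neg_neg] using h.neg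
  · simpa only [neg_neg] using isBddFun_neg h
  · have hvisc := h (fun y => -φ y) x δ hδ hφ.neg (isBddFun_neg hφb) fun y hy => by
      linarith [hmax y hy, Pi.neg_apply u x, Pi.neg_apply u y]
    have := viscExpr_neg lam ν H u (fun y => -φ y) x δ
    simp only [neg_neg] at this
    change viscExpr lam ν _ _ φ x δ ≤ 0
    linarith
  · have hvisc := h (fun y => -φ y) x δ hδ hφ.neg (isBddFun_neg hφb) fun y hy => by
      linarith [hmin y hy, Pi.neg_apply u x, Pi.neg_apply u y]
    rw [viscExpr_neg] at hvisc
    linarith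

/-! ### Semicontinuity of the equation -/

section semicontinuity

variable {u φ : Space N → ℝ} {x : Space N} {s t : ℝ}

lemma exists_levyBounded_patch (hu : Measurable u) (hub : IsBddFun u) (hφ : IsTestOn φ x t)
    (hs : 0 < s) (hst : s < t) :
    ∃ C > 0, ∀ᶠ y in 𝓝 x, ∀ c : ℝ, |c| ≤ 1 →
      LevyBounded C (levyIntegrand (patch u (fun z => φ z + c) y s) y (gradient φ y)) := by
  obtain ⟨K₁, hK₁⟩ := hub
  obtain ⟨K₂, hK₂⟩ := hφ.bdd
  obtain ⟨ρ, hρ, C, hC, hT⟩ := exists_taylor_bound hφ.contDiffAt_center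
  have hK₁0 : 0 ≤ K₁ := (abs_nonneg _).trans (hK₁ x)
  refine ⟨C + (2 * max K₁ (K₂ + 1) + (‖gradient φ x‖ + 1)) / min (ρ / 2) (min 1 s) ^ 2,
    by positivity, ?_⟩
  have hgrad : ∀ᶠ y in 𝓝 x, ‖gradient φ y‖ ≤ ‖gradient φ x‖ + 1 :=
    (continuousAt_gradient hφ.contDiffAt_center).norm.eventually_le_const (lt_add_one _)
  filter_upwards [hgrad, ball_mem_nhds x (half_pos hρ), ball_mem_nhds x (sub_pos.2 hst)]
    with y hy hyρ hyt c hc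
  have hball : ball y s ⊆ ball x t := ball_subset_ball' (by linarith [mem_ball.1 hyt])
  refine levyBounded_levyIntegrand_patch hu (fun z => (hK₁ z).trans (le_max_left _ _))
    ((hφ.contDiffOn.continuousOn.mono hball).add continuousOn_const)
    (fun z hz => ((abs_add_le _ _).trans (add_le_add (hK₂ z (hball hz)) hc)).trans
      (le_max_right _ _)) hy (by positivity) ((min_le_right _ _).trans (min_le_left _ _))
    ((min_le_right _ _).trans (min_le_right _ _)) hC fun z hz => ?_
  have hzρ : ‖z‖ < ρ / 2 := hz.trans_le (min_le_left _ _)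
  have hyz : y + z ∈ ball x ρ := by
    have := dist_triangle (y + z) y x
    rw [dist_self_add_left] at this
    exact mem_ball.2 (by linarith [mem_ball.1 hyρ])
  rw [add_sub_add_right_eq_sub]
  exact hT y z (ball_subset_ball (by linarith) hyρ) hyz

lemma continuousAt_indicator_inner {p : Space N → Space N} (hp : ContinuousAt p x) (z : Space N) :
    ContinuousAt (fun y => (ball (0 : Space N) 1).indicator (fun w => inner ℝ (p y) w) z) x := by
  by_cases hz : z ∈ ball (0 : Space N) 1
  · simpa only [Set.indicator_of_mem hz] using hp.inner continuousAt_const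
  · simpa only [Set.indicator_of_notMem hz] using continuousAt_const

lemma eventually_levyIntegrand_patch_le (hu : UpperSemicontinuous u) (hφ : IsTestOn φ x t)
    (hst : s < t) (hs : 0 < s) (z : Space N) {η : ℝ} (hη : 0 < η) :
    ∀ᶠ q : Space N × ℝ in 𝓝 (x, 0),
      levyIntegrand (patch u (fun y => φ y + q.2) q.1 s) q.1 (gradient φ q.1) z ≤
        levyIntegrand (patch u φ x s) x (gradient φ x) z + η := by
  have hfst : Tendsto Prod.fst (𝓝 (x, (0 : ℝ))) (𝓝 x) := continuous_fst.tendsto (x, (0 : ℝ))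
  have hsnd : Tendsto Prod.snd (𝓝 (x, (0 : ℝ))) (𝓝 0) := continuous_snd.tendsto (x, (0 : ℝ))
  have hind := ((continuousAt_indicator_inner
    (continuousAt_gradient hφ.contDiffAt_center) z).tendsto.comp hfst).eventually
      (lt_mem_nhds (sub_lt_self _ (by positivity : 0 < η / 4)))
  have hcenter := (hφ.contDiffAt_center.continuousAt.tendsto.comp hfst).eventually
    (lt_mem_nhds (sub_lt_self _ (by positivity : 0 < η / 4)))
  simp only [levyIntegrand, patch_center hs]
  by_cases hz : ‖z‖ < s
  · have hxz : x + z ∈ ball x t := by simpa using hz.trans hst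
    have hcont : ContinuousAt φ (x + z) := (hφ.contDiffAt hxz).continuousAt
    have hval := (hcont.tendsto.comp (hfst.add_const z)).eventually
      (gt_mem_nhds (lt_add_of_pos_right _ (by positivity : 0 < η / 4)))
    filter_upwards [hind, hcenter, hval] with q hq₁ hq₂ hq₃
    simp only [Function.comp_apply] at hq₁ hq₂ hq₃
    rw [patch_of_mem (by simpa using hz), patch_of_mem (by simpa using hz)]
    linarith
  · have hval := (hfst.add_const z).eventually
      (hu (x + z) (u (x + z) + η / 4) (lt_add_of_pos_right _ (by positivity)))
    have hc := hsnd.eventually (lt_mem_nhds (neg_lt_zero.2 (by positivity : 0 < η / 4)))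
    filter_upwards [hind, hcenter, hval, hc] with q hq₁ hq₂ hq₃ hq₄
    simp only [Function.comp_apply] at hq₁ hq₂
    rw [patch_of_notMem (by simpa using hz), patch_of_notMem (by simpa using hz)]
    linarith

lemma eventually_residual_patch_gt {ν : Space N → Measure (Space N)}
    (hν : ∀ ξ, IsLevyMeasure (ν ξ)) (hM2 : AssumptionM2 ν) (hM3 : AssumptionM3 ν)
    (hM4 : AssumptionM4 ν) {H : Space N → Space N → ℝ}
    (hH : Continuous fun q : Space N × Space N => H q.1 q.2) (lam : ℝ)
    (hu : UpperSemicontinuous u) (hub : IsBddFun u) (hφ : IsTestOn φ x t) (hs : 0 < s)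
    (hst : s < t) {η : ℝ} (hη : 0 < η) :
    ∀ᶠ q : Space N × ℝ in 𝓝 (x, 0),
      residual lam ν H (patch u φ x s) x (gradient φ x) - η <
        residual lam ν H (patch u (fun y => φ y + q.2) q.1 s) q.1 (gradient φ q.1) := by
  have hfst : Tendsto Prod.fst (𝓝 (x, (0 : ℝ))) (𝓝 x) := continuous_fst.tendsto (x, (0 : ℝ))
  have hsnd : Tendsto Prod.snd (𝓝 (x, (0 : ℝ))) (𝓝 0) := continuous_snd.tendsto (x, (0 : ℝ))
  obtain ⟨C, hC, hbdd⟩ := exists_levyBounded_patch hu.measurable hub hφ hs hst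
  have hbdd_center : LevyBounded C (levyIntegrand (patch u φ x s) x (gradient φ x)) := by
    simpa only [add_zero] using hbdd.self_of_nhds 0 (by simp)
  have hinteg := eventually_integral_le hν hM2 hM3 hM4 hfst hC
    (F := fun q => levyIntegrand (patch u (fun y => φ y + q.2) q.1 s) q.1 (gradient φ q.1))
    (by
      filter_upwards [hfst.eventually hbdd,
        hsnd.abs.eventually_le_const (by norm_num : |(0 : ℝ)| < 1)] with q hq₁ hq₂
      exact hq₁ q.2 hq₂)
    hbdd_center (fun z _ => eventually_levyIntegrand_patch_le hu hφ hst hs z) (half_pos hη)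
  have hgrad := (continuousAt_gradient hφ.contDiffAt_center).tendsto.comp hfst
  have hlocal : Tendsto (fun q : Space N × ℝ => lam * (φ q.1 + q.2) + H q.1 (gradient φ q.1))
      (𝓝 (x, 0)) (𝓝 (lam * (φ x + 0) + H x (gradient φ x))) :=
    (((hφ.contDiffAt_center.continuousAt.tendsto.comp hfst).add hsnd).const_mul lam).add
      ((hH.tendsto (x, gradient φ x)).comp (hfst.prodMk_nhds hgrad))
  filter_upwards [hinteg, hlocal.eventually (lt_mem_nhds (sub_lt_self _ (half_pos hη)))]
    with q hq₁ hq₂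
  unfold residual
  rw [patch_center hs, patch_center hs]
  linarith

end semicontinuity

/-! ### Upper envelopes -/

section upperEnvelope

lemma isBoundedUnder_le_of_abs_le {X : Type*} {f : X → ℝ} {K : ℝ} (hf : ∀ x, |f x| ≤ K)
    (l : Filter X) : IsBoundedUnder (· ≤ ·) l f :=
  isBoundedUnder_of ⟨K, fun y => (abs_le.1 (hf y)).2⟩

lemma isCoboundedUnder_le_of_abs_le {X : Type*} {f : X → ℝ} {K : ℝ} (hf : ∀ x, |f x| ≤ K)
    (l : Filter X) [l.NeBot] :
    IsCoboundedUnder (· ≤ ·) l f :=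
  (isBoundedUnder_of ⟨-K, fun y => (abs_le.1 (hf y)).1⟩ :
    IsBoundedUnder (· ≥ ·) l f).isCoboundedUnder_le

variable {X : Type*} [TopologicalSpace X] {f : X → ℝ} {K : ℝ}

/-- The upper semicontinuous envelope of a bounded function. -/
noncomputable def upperEnvelope (f : X → ℝ) (x : X) : ℝ := limsup f (𝓝 x)

lemma le_upperEnvelope (hf : ∀ x, |f x| ≤ K) (x : X) : f x ≤ upperEnvelope f x := by
  by_contra! h
  exact (eventually_lt_of_limsup_lt h (isBoundedUnder_le_of_abs_le hf _)).self_of_nhds.false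

lemma abs_upperEnvelope_le (hf : ∀ x, |f x| ≤ K) (x : X) : |upperEnvelope f x| ≤ K :=
  abs_le.2 ⟨(abs_le.1 (hf x)).1.trans (le_upperEnvelope hf x),
    limsup_le_of_le (isCoboundedUnder_le_of_abs_le hf _)
      (Eventually.of_forall fun y => (abs_le.1 (hf y)).2)⟩

lemma frequently_lt_of_lt_upperEnvelope (hf : ∀ x, |f x| ≤ K) {x : X} {c : ℝ}
    (hc : c < upperEnvelope f x) : ∃ᶠ y in 𝓝 x, c < f y :=
  frequently_lt_of_lt_limsup (isCoboundedUnder_le_of_abs_le hf _) hc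

lemma upperSemicontinuous_upperEnvelope (hf : ∀ x, |f x| ≤ K) :
    UpperSemicontinuous (upperEnvelope f) := by
  intro x c hc
  obtain ⟨c', hlt, hlt'⟩ := exists_between hc
  have hev := eventually_lt_of_limsup_lt hlt (isBoundedUnder_le_of_abs_le hf _)
  filter_upwards [hev.eventually_nhds] with y hy
  exact (limsup_le_of_le (isCoboundedUnder_le_of_abs_le hf _) (hy.mono fun _ => le_of_lt)).trans_lt
    hlt'

end upperEnvelope

/-! ### Stability of subsolutions -/

section stability

variable {lam : ℝ} {ν : Space N → Measure (Space N)} {H : Space N → Space N → ℝ}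
  {u v w φ : Space N → ℝ} {x : Space N} {s t : ℝ}

lemma residual_patch_le_of_le (hν : ∀ ξ, IsLevyMeasure (ν ξ))
    (hw : IsViscositySubsolution lam ν H w) (hv : Measurable v) (hvb : IsBddFun v)
    (hwv : ∀ y, w y ≤ v y) (hφ : IsTestOn φ x s) (hx : φ x = w x)
    (hle : ∀ y ∈ ball x s, w y ≤ φ y) :
    residual lam ν H (patch v φ x s) x (gradient φ x) ≤ 0 := by
  have hmax : IsLocalMax (fun y => w y - φ y) x :=
    eventually_of_mem (ball_mem_nhds x hφ.pos) fun y hy => by linarith [hle y hy]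
  obtain ⟨hinteg, hres⟩ := hw.residual_le hν hφ.contDiffAt_center hmax
  exact (residual_anti hinteg (hφ.integrable_levyIntegrand_patch hv hvb (hν x)) (le_patch hwv hle)
    (hx.symm.trans (patch_center hφ.pos).symm)).trans hres

lemma exists_isMaxOn_sub_near {η κ : ℝ} (hη : 0 ≤ η) (hw : UpperSemicontinuous w)
    (hφ : ContinuousOn φ (closedBall x s))
    (hle : ∀ y ∈ closedBall x s, w y + η * ‖y - x‖ ^ 2 ≤ φ y) {y₀ : Space N}
    (hy₀ : y₀ ∈ closedBall x s) (hκ : φ y₀ - κ < w y₀) :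
    ∃ y, IsMaxOn (fun y => w y - φ y) (closedBall x s) y ∧
      |w y - φ y| < κ ∧ η * ‖y - x‖ ^ 2 < κ := by
  obtain ⟨y, hy, hmax⟩ := UpperSemicontinuousOn.exists_isMaxOn ⟨y₀, hy₀⟩ (isCompact_closedBall x s)
    ((hw.upperSemicontinuousOn _).add hφ.neg.upperSemicontinuousOn)
  have hval : w y₀ - φ y₀ ≤ w y - φ y := hmax hy₀
  have hy_le := hle y hy
  have hsq : 0 ≤ η * ‖y - x‖ ^ 2 := by positivity
  exact ⟨y, hmax, abs_lt.2 ⟨by linarith, by linarith⟩, by linarith⟩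

lemma exists_isMaxOn_sub_of_frequently {S : Set (Space N → ℝ)} {η σ : ℝ}
    (hS : ∀ w ∈ S, UpperSemicontinuous w) (hle : ∀ w ∈ S, ∀ y, w y ≤ v y)
    (hfreq : ∀ c < v x, ∃ᶠ y in 𝓝 x, ∃ w ∈ S, c < w y) (hs : 0 < s)
    (hφ : ContinuousOn φ (closedBall x s)) (hx : φ x = v x) (hη : 0 < η)
    (htouch : ∀ y ∈ closedBall x s, v y + η * ‖y - x‖ ^ 2 ≤ φ y) (hσ : 0 < σ) :
    ∃ w ∈ S, ∃ y, IsMaxOn (fun y => w y - φ y) (closedBall x s) y ∧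
      |w y - φ y| < σ ∧ dist y x < σ := by
  set κ := min σ (η * σ ^ 2)
  have hκ : 0 < κ := by positivity
  have hnhds := closedBall_mem_nhds x hs
  obtain ⟨y₀, ⟨w, hw, hwy₀⟩, hφy₀, hy₀⟩ := ((hfreq (v x - κ / 2) (by linarith)).and_eventually
    (((hφ.continuousAt hnhds).eventually_lt_const
      (show φ x < v x + κ / 2 by linarith)).and hnhds)).exists
  obtain ⟨y, hmax, hyκ, hyx⟩ := exists_isMaxOn_sub_near hη.le (hS w hw) hφ
    (fun z hz => (add_le_add_left (hle w hw z) _).trans (htouch z hz)) hy₀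
    (show φ y₀ - κ < w y₀ by linarith)
  refine ⟨w, hw, y, hmax, hyκ.trans_le (min_le_left _ _), ?_⟩
  rw [dist_eq_norm]
  exact lt_of_pow_lt_pow_left₀ 2 hσ.le
    (lt_of_mul_lt_mul_left (hyx.trans_le (min_le_right _ _)) hη.le)

theorem isViscositySubsolution_of_frequently (hν : ∀ ξ, IsLevyMeasure (ν ξ)) (hM2 : AssumptionM2 ν)
    (hM3 : AssumptionM3 ν) (hM4 : AssumptionM4 ν)
    (hH : Continuous fun q : Space N × Space N => H q.1 q.2) {S : Set (Space N → ℝ)}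
    (hS : ∀ w ∈ S, IsViscositySubsolution lam ν H w) (hv : UpperSemicontinuous v)
    (hvb : IsBddFun v) (hle : ∀ w ∈ S, ∀ y, w y ≤ v y)
    (hfreq : ∀ x, ∀ c < v x, ∃ᶠ y in 𝓝 x, ∃ w ∈ S, c < w y) :
    IsViscositySubsolution lam ν H v := by
  refine isViscositySubsolution_of_strict hν hv hvb fun φ x t η hη hφ hx htouch =>
    ⟨t / 4, by linarith [hφ.pos], by linarith [hφ.pos], ?_⟩
  have ht := hφ.pos
  by_contra! hpos
  have hnear := eventually_residual_patch_gt hν hM2 hM3 hM4 hH lam hv hvb hφ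
    (by positivity : 0 < t / 4) (by linarith) hpos
  rw [sub_self] at hnear
  obtain ⟨ρ, hρ, hnear⟩ := Metric.eventually_nhds_iff.1 hnear
  have hsub : closedBall x (t / 2) ⊆ ball x t := closedBall_subset_ball (by linarith)
  obtain ⟨w, hw, y, hmax, hφy, hyx⟩ := exists_isMaxOn_sub_of_frequently (fun w hw => (hS w hw).1)
    hle (hfreq x) (half_pos ht) (hφ.contDiffOn.continuousOn.mono hsub) hx hη
    (fun z hz => htouch z (hsub hz)) (by positivity : 0 < min ρ (t / 4))
  have hball : ball y (t / 4) ⊆ closedBall x (t / 2) := (ball_subset_ball' (by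
    linarith [hyx.trans_le (min_le_right ρ (t / 4))])).trans ball_subset_closedBall
  have hq : dist (y, w y - φ y) (x, (0 : ℝ)) < ρ := by
    rw [Prod.dist_eq, max_lt_iff, Real.dist_eq, sub_zero]
    exact ⟨hyx.trans_le (min_le_left _ _), hφy.trans_le (min_le_left _ _)⟩
  have hle0 := residual_patch_le_of_le hν (hS w hw) hv.measurable hvb (hle w hw)
    ((hφ.of_ball_subset (by positivity) (hball.trans hsub)).add_const (w y - φ y)) (by ring)
    fun z hz => by linarith [isMaxOn_iff.1 hmax z (hball hz)]
  rw [gradient_add_const] at hle0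
  exact (hnear hq).not_ge hle0

end stability

/-! ### Maximal subsolutions -/

section bump

variable {lam : ℝ} {ν : Space N → Measure (Space N)} {H : Space N → Space N → ℝ}
  {u b φ : Space N → ℝ} {x : Space N} {σ t : ℝ}

/-- The bump construction of Perron's method: `u` is replaced by `max u b` on the ball of radius
`t` about `x`. -/
noncomputable def bump (u b : Space N → ℝ) (x : Space N) (t : ℝ) : Space N → ℝ :=
  patch u (fun y => max (u y) (b y)) x t

lemma le_bump (y : Space N) : u y ≤ bump u b x t y :=
  le_patch (fun _ => le_rfl) (fun _ _ => le_max_left _ _) y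

lemma le_bump_of_mem {y : Space N} (hy : y ∈ ball x t) : b y ≤ bump u b x t y := by
  rw [bump, patch_of_mem hy]
  exact le_max_right _ _

lemma bump_eq_left_or (y : Space N) :
    bump u b x t y = u y ∨ y ∈ ball x t ∧ bump u b x t y = b y := by
  by_cases hy : y ∈ ball x t
  · rw [bump, patch_of_mem hy]
    exact (max_choice (u y) (b y)).imp_right fun h => ⟨hy, h⟩
  · exact Or.inl (patch_of_notMem hy)

lemma isBddFun_bump (hu : IsBddFun u) (hb : IsTestOn b x t) : IsBddFun (bump u b x t) := by
  obtain ⟨K₁, hK₁⟩ := hu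
  obtain ⟨K₂, hK₂⟩ := hb.bdd
  exact ⟨max K₁ K₂, abs_patch_le (fun y => (hK₁ y).trans (le_max_left _ _)) fun y hy =>
    abs_max_le_max_abs_abs.trans (max_le_max (hK₁ y) (hK₂ y hy))⟩

lemma upperSemicontinuous_bump (hu : UpperSemicontinuous u) (hb : ContinuousOn b (ball x t))
    (hσt : σ < t) (hfar : ∀ y ∈ ball x t, σ ≤ dist y x → b y ≤ u y) :
    UpperSemicontinuous (bump u b x t) := by
  intro y c hc
  by_cases hy : y ∈ ball x t
  · rw [bump, patch_of_mem hy, max_lt_iff] at hc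
    filter_upwards [hu y c hc.1, (hb.continuousAt (isOpen_ball.mem_nhds hy)).eventually_lt_const
      hc.2, isOpen_ball.mem_nhds hy] with z hzu hzb hz
    rw [bump, patch_of_mem hz]
    exact max_lt hzu hzb
  · rw [bump, patch_of_notMem hy] at hc
    have hyσ : ∀ᶠ z in 𝓝 y, σ < dist z x := (continuous_id.dist continuous_const).continuousAt
      |>.eventually_const_lt (hσt.trans_le (not_lt.1 hy))
    filter_upwards [hu y c hc, hyσ] with z hzu hz
    unfold bump patch
    split_ifs with hzt
    exacts [max_lt hzu ((hfar z hzt hz.le).trans_lt hzu), hzu]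

lemma isViscositySubsolution_bump (hν : ∀ ξ, IsLevyMeasure (ν ξ))
    (hu : IsViscositySubsolution lam ν H u) (hb : IsTestOn b x t)
    (husc : UpperSemicontinuous (bump u b x t))
    (hres : ∀ y ∈ ball x t, u y < b y → ∃ w, w y = b y ∧ (∀ z, w z ≤ bump u b x t z) ∧
      Integrable (levyIntegrand w y (gradient b y)) (ν y) ∧
      residual lam ν H w y (gradient b y) ≤ 0) :
    IsViscositySubsolution lam ν H (bump u b x t) := by
  have hbdd := isBddFun_bump hu.2.1 hb
  refine isViscositySubsolution_of_strict hν husc hbdd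
    fun φ y s η hη hφ hy htouch => ⟨s, hφ.pos, le_rfl, ?_⟩
  have hle : ∀ z ∈ ball y s, bump u b x t z ≤ φ z := fun z hz => by
    have : 0 ≤ η * ‖z - y‖ ^ 2 := by positivity
    linarith [htouch z hz]
  rcases eq_or_lt_of_le (le_bump (b := b) (x := x) (t := t) (u := u) y) with huy | huy
  · exact residual_patch_le_of_le hν hu husc.measurable hbdd le_bump hφ (hy.trans huy.symm)
      fun z hz => (le_bump z).trans (hle z hz)
  obtain ⟨hyt, hby⟩ := (bump_eq_left_or y).resolve_left huy.ne'
  obtain ⟨w, hwy, hwle, hinteg, hw⟩ := hres y hyt (hby ▸ huy)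
  have hgrad : gradient b y = gradient φ y := by
    refine gradient_eq_of_isLocalMax_sub ((hb.contDiffAt hyt).differentiableAt (by simp))
      hφ.differentiableAt ?_
    filter_upwards [isOpen_ball.mem_nhds hyt, ball_mem_nhds y hφ.pos] with z hz hz'
    linarith [hle z hz', le_bump_of_mem (u := u) (b := b) hz]
  rw [hgrad] at hinteg hw
  refine (residual_anti hinteg (hφ.integrable_levyIntegrand_patch husc.measurable hbdd (hν y))
    (le_patch hwle fun z hz => (hwle z).trans (hle z hz)) ?_).trans hw
  rw [patch_center hφ.pos, hwy, hy, hby]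

end bump

section maximal

variable {lam : ℝ} {ν : Space N → Measure (Space N)} {H : Space N → Space N → ℝ}
  {u v φ : Space N → ℝ} {x y : Space N} {s t κ : ℝ}

lemma bump_residual_le (hν : ∀ ξ, IsLevyMeasure (ν ξ)) (hv : Measurable v) (hvb : IsBddFun v)
    (huv : ∀ z, -v z ≤ u z) (hφ : IsTestOn φ y s) (hsub : ball y s ⊆ ball x t)
    (hres : 0 < residual lam ν (fun x p => -H x (-p)) (patch v (fun z => φ z + -κ) y s) y
      (gradient φ y)) :
    ∃ w, w y = -(φ y + -κ) ∧ (∀ z, w z ≤ bump u (fun z => -(φ z + -κ)) x t z) ∧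
      Integrable (levyIntegrand w y (gradient (fun z => -(φ z + -κ)) y)) (ν y) ∧
      residual lam ν H w y (gradient (fun z => -(φ z + -κ)) y) ≤ 0 := by
  have hgrad : gradient (fun z => -(φ z + -κ)) y = -gradient φ y := by
    rw [← gradient_add_const φ (-κ) y]
    exact gradient_neg _ _
  have hinteg := (hφ.add_const (-κ)).integrable_levyIntegrand_patch hv hvb (hν y)
  rw [gradient_add_const] at hinteg
  rw [hgrad]
  refine ⟨-patch v (fun z => φ z + -κ) y s, ?_, fun z => ?_, ?_, ?_⟩
  · rw [Pi.neg_apply, patch_center hφ.pos]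
  · by_cases hz : z ∈ ball y s
    · rw [Pi.neg_apply, patch_of_mem hz]
      exact le_bump_of_mem (b := fun z => -(φ z + -κ)) (hsub hz)
    · rw [Pi.neg_apply, patch_of_notMem hz]
      exact (huv z).trans (le_bump z)
  · exact hinteg.neg.congr (Eventually.of_forall fun z => (levyIntegrand_neg _ _ _ z).symm)
  · have hneg := residual_neg lam ν (fun x p => -H x (-p)) (patch v (fun z => φ z + -κ) y s) y
      (gradient φ y)
    simp only [neg_neg] at hneg
    linarith

lemma dist_lt_of_touch {η σ : ℝ} (hη : 0 < η) (hσ : 0 ≤ σ) (hκ : κ ≤ η * σ ^ 2)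
    (huv : -v y ≤ u y) (htouch : v y + η * ‖y - x‖ ^ 2 ≤ φ y) (hy : u y < -(φ y + -κ)) :
    dist y x < σ := by
  rw [dist_eq_norm]
  exact lt_of_pow_lt_pow_left₀ 2 hσ (lt_of_mul_lt_mul_left (by linarith) hη.le)

lemma isViscositySubsolution_bump_of_residual_pos {η σ : ℝ} (hν : ∀ ξ, IsLevyMeasure (ν ξ))
    (hu : IsViscositySubsolution lam ν H u) (hv : Measurable v) (hvb : IsBddFun v)
    (huv : ∀ y, -v y ≤ u y) (hη : 0 < η) (hφ : IsTestOn φ x t)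
    (htouch : ∀ y ∈ ball x t, v y + η * ‖y - x‖ ^ 2 ≤ φ y) (hσ : 0 < σ) (hσt : σ ≤ t / 2)
    (hκ : κ ≤ η * σ ^ 2)
    (hpos : ∀ y, dist y x < σ → 0 < residual lam ν (fun x p => -H x (-p))
      (patch v (fun z => φ z + -κ) y (t / 2)) y (gradient φ y)) :
    IsViscositySubsolution lam ν H (bump u (fun z => -(φ z + -κ)) x t) := by
  have ht := hφ.pos
  have htest : IsTestOn (fun z => -(φ z + -κ)) x t := (hφ.add_const (-κ)).neg
  have hclose : ∀ y ∈ ball x t, u y < -(φ y + -κ) → dist y x < σ := fun y hy =>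
    dist_lt_of_touch hη hσ.le hκ (huv y) (htouch y hy)
  refine isViscositySubsolution_bump hν hu htest (upperSemicontinuous_bump hu.1
    htest.contDiffOn.continuousOn (hσt.trans_lt (half_lt_self ht))
    fun y hy hfar => not_lt.1 fun hlt => (hclose y hy hlt).not_ge hfar) fun y hy hlt => ?_
  have hsub : ball y (t / 2) ⊆ ball x t := ball_subset_ball' (by linarith [hclose y hy hlt])
  exact bump_residual_le hν hv hvb huv (hφ.of_ball_subset (by positivity) hsub) hsub
    (hpos y (hclose y hy hlt))

-- If the reflected inequality failed, lowering `-φ` by less than the touching gap and bumping `u`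
-- up to it would produce a strictly larger subsolution.
theorem isViscositySubsolution_upperEnvelope_neg (hν : ∀ ξ, IsLevyMeasure (ν ξ))
    (hM2 : AssumptionM2 ν) (hM3 : AssumptionM3 ν) (hM4 : AssumptionM4 ν)
    (hH : Continuous fun q : Space N × Space N => H q.1 q.2)
    (hu : IsViscositySubsolution lam ν H u)
    (hmax : ∀ w, IsViscositySubsolution lam ν H w → (∀ y, u y ≤ w y) → ∀ y, w y ≤ u y) :
    IsViscositySubsolution lam ν (fun x p => -H x (-p)) (upperEnvelope (-u)) := by
  obtain ⟨K, hK⟩ := isBddFun_neg hu.2.1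
  have hv : UpperSemicontinuous (upperEnvelope (-u)) := upperSemicontinuous_upperEnvelope hK
  have hvb : IsBddFun (upperEnvelope (-u)) := ⟨K, abs_upperEnvelope_le hK⟩
  have huv : ∀ y, -upperEnvelope (-u) y ≤ u y := fun y => neg_le.1 (le_upperEnvelope hK y)
  refine isViscositySubsolution_of_strict hν hv hvb fun φ x t η hη hφ hx htouch =>
    ⟨t / 2, by linarith [hφ.pos], by linarith [hφ.pos], ?_⟩
  have ht := hφ.pos
  by_contra! hpos
  have hnear := eventually_residual_patch_gt (H := fun x p => -H x (-p)) hν hM2 hM3 hM4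
    (hH.comp (continuous_fst.prodMk continuous_snd.neg)).neg lam hv hvb hφ
    (by positivity : 0 < t / 2) (by linarith) hpos
  rw [sub_self] at hnear
  obtain ⟨ρ, hρ, hnear⟩ := Metric.eventually_nhds_iff.1 hnear
  set σ := min ρ (t / 2)
  have hσ : 0 < σ := by positivity
  set κ := min (ρ / 2) (η * σ ^ 2)
  have hκ : 0 < κ := by positivity
  have hbump := isViscositySubsolution_bump_of_residual_pos hν hu hv.measurable hvb huv hη hφ
    htouch hσ (min_le_right ρ (t / 2)) (min_le_right (ρ / 2) (η * σ ^ 2)) fun y hy =>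
      hnear (y := (y, -κ)) (by
        rw [Prod.dist_eq, max_lt_iff, Real.dist_eq, sub_zero, abs_neg, abs_of_pos hκ]
        exact ⟨hy.trans_le (min_le_left _ _), (min_le_left _ _).trans_lt (half_lt_self hρ)⟩)
  obtain ⟨y, hy, hφy, hyt⟩ := ((frequently_lt_of_lt_upperEnvelope hK
    (show φ x - κ / 2 < upperEnvelope (-u) x by linarith)).and_eventually
      ((hφ.contDiffAt_center.continuousAt.eventually_lt_const
        (show φ x < φ x + κ / 2 by linarith)).and (ball_mem_nhds x ht))).exists
  have hle := (le_bump_of_mem hyt).trans (hmax _ hbump le_bump y)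
  rw [Pi.neg_apply] at hy
  linarith

end maximal

section const

variable {lam c : ℝ} {ν : Space N → Measure (Space N)} {H : Space N → Space N → ℝ}

lemma isViscositySubsolution_const (hν : ∀ ξ, IsLevyMeasure (ν ξ))
    (hc : ∀ x, lam * c + H x 0 ≤ 0) : IsViscositySubsolution lam ν H (fun _ => c) := by
  have hbdd : IsBddFun fun _ : Space N => c := ⟨|c|, fun _ => le_rfl⟩
  refine isViscositySubsolution_of_strict hν continuous_const.upperSemicontinuous hbdd
    fun φ x t η hη hφ hx htouch => ⟨t, hφ.pos, le_rfl, ?_⟩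
  have hle : ∀ y ∈ ball x t, c ≤ φ y := fun y hy => by
    have : 0 ≤ η * ‖y - x‖ ^ 2 := by positivity
    linarith [htouch y hy]
  have hgrad : gradient φ x = 0 := by
    rw [← gradient_eq_of_isLocalMax_sub (differentiableAt_const c) hφ.differentiableAt
      (eventually_of_mem (ball_mem_nhds x hφ.pos) fun y hy => by linarith [hle y hy])]
    exact gradient_fun_const x c
  have hzero : levyIntegrand (fun _ => c) x 0 = fun _ : Space N => (0 : ℝ) := by
    ext z
    simp [levyIntegrand]
  have hanti := residual_anti (lam := lam) (H := H) (ν := ν) (u := fun _ => c)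
    (by rw [hgrad, hzero]; exact integrable_zero _ _ _)
    (hφ.integrable_levyIntegrand_patch measurable_const hbdd (hν x))
    (le_patch (fun _ => le_rfl) hle) (hx.symm.trans (patch_center hφ.pos).symm)
  refine hanti.trans ?_
  rw [hgrad, residual, hzero, integral_zero]
  linarith [hc x]

lemma isViscositySupersolution_const (hν : ∀ ξ, IsLevyMeasure (ν ξ))
    (hc : ∀ x, 0 ≤ lam * c + H x 0) : IsViscositySupersolution lam ν H (fun _ => c) :=
  isViscositySupersolution_iff_neg.2 <| isViscositySubsolution_const (c := -c) hν fun x => by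
    rw [neg_zero]
    linarith [hc x]

end const

/-! ### The Hamiltonian -/

section hamiltonian

variable {H : Space N → Space N → ℝ} {m : ℝ}

lemma rpow_sub_one_le_one_add_rpow {t : ℝ} (ht : 0 ≤ t) (hm : 1 ≤ m) :
    t ^ (m - 1) ≤ 1 + t ^ m := by
  rcases le_total t 1 with h | h
  · have := Real.rpow_le_one ht h (sub_nonneg.2 hm)
    have := Real.rpow_nonneg ht m
    linarith
  · have := Real.rpow_le_rpow_of_exponent_le h (sub_le_self m zero_le_one)
    linarith

lemma self_le_one_add_rpow {t : ℝ} (ht : 0 ≤ t) (hm : 1 ≤ m) : t ≤ 1 + t ^ m := by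
  rcases le_total t 1 with h | h
  · linarith [Real.rpow_nonneg ht m]
  · linarith [Real.self_le_rpow_of_one_le h hm]

lemma AssumptionH1.exists_dist (h : AssumptionH1 H m) (hm : 1 ≤ m) {ε : ℝ} (hε : 0 < ε) :
    ∃ δ > 0, δ ≤ 1 ∧ ∀ x y p q, ‖x - y‖ < δ → ‖q‖ < δ →
      H y (p + q) - H x p ≤ ε * (1 + ‖p‖ ^ m) := by
  obtain ⟨ω₁, ω₂, hω₁, hω₂, h⟩ := h
  obtain ⟨s₁, hs₁, hω₁⟩ := hω₁.exists_lt (show 0 < ε / 3 by positivity)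
  obtain ⟨s₂, hs₂, hω₂⟩ := hω₂.exists_lt (show 0 < ε / 3 by positivity)
  refine ⟨min (min s₁ s₂) 1, by positivity, min_le_right _ _, fun x y p q hxy hq => ?_⟩
  have hω₁xy := hω₁ ‖x - y‖₊ (hxy.trans_le ((min_le_left _ _).trans (min_le_left _ _)))
  have hω₂q := hω₂ ‖q‖₊ (hq.trans_le ((min_le_left _ _).trans (min_le_right _ _)))
  have hpow := rpow_sub_one_le_one_add_rpow (norm_nonneg p) hm
  have hT : 0 ≤ ‖p‖ ^ m := by positivity
  calc H y (p + q) - H x p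
      ≤ ω₁ ‖x - y‖₊ * (1 + ‖p‖ ^ m) + ω₂ ‖q‖₊ * (1 + ‖p‖ ^ (m - 1)) :=
        h x y p q (hq.le.trans (min_le_right _ _))
    _ ≤ ε / 3 * (1 + ‖p‖ ^ m) + ε / 3 * (2 * (1 + ‖p‖ ^ m)) := by gcongr; linarith
    _ = ε * (1 + ‖p‖ ^ m) := by ring

lemma exists_hamiltonian_le (hm : 1 ≤ m) (hH0 : AssumptionH0 H) (hH1 : AssumptionH1 H m) (ρ : ℝ) :
    ∃ C, ∀ x p, ‖p‖ ≤ ρ → H x p ≤ C := by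
  obtain ⟨C₀, hC₀⟩ := hH0.2
  obtain ⟨δ, hδ, -, hH1⟩ := hH1.exists_dist hm one_pos
  have hball : ∀ n : ℕ, ∃ C, ∀ x p, ‖p‖ ≤ n * (δ / 2) → H x p ≤ C := by
    intro n
    induction n with
    | zero =>
      refine ⟨C₀, fun x p hp => ?_⟩
      obtain rfl : p = 0 := by simpa using hp
      exact (le_abs_self _).trans (hC₀ x)
    | succ n ih =>
      obtain ⟨C, hC⟩ := ih
      refine ⟨1 * (1 + (n * (δ / 2)) ^ m) + C, fun x p hp => ?_⟩
      obtain ⟨p', hp', hpp'⟩ := exists_dist_le_le (x := (0 : Space N)) (z := p)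
        (show 0 ≤ n * (δ / 2) by positivity) (show 0 ≤ δ / 2 by positivity)
        (by rw [dist_zero_left]; push_cast at hp; linarith)
      rw [dist_zero_left] at hp'
      have hstep := hH1 x x p' (p - p') (by simpa using hδ) (by
        rw [← dist_eq_norm, dist_comm]
        linarith)
      rw [add_sub_cancel] at hstep
      calc H x p ≤ 1 * (1 + ‖p'‖ ^ m) + H x p' := by linarith
        _ ≤ 1 * (1 + (n * (δ / 2)) ^ m) + C := by
          gcongr
          exact hC x p' hp'
  obtain ⟨n, hn⟩ := exists_nat_ge (ρ / (δ / 2))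
  obtain ⟨C, hC⟩ := hball n
  exact ⟨C, fun x p hp => hC x p (hp.trans ((div_le_iff₀ (by positivity)).1 hn))⟩

lemma eventually_nhdsLT_one_lt {f : ℝ → ℝ} (hf : ContinuousAt f 1) {c : ℝ} (hc : f 1 < c) :
    ∀ᶠ μ in 𝓝[<] (1 : ℝ), f μ < c :=
  (hf.eventually_lt_const hc).filter_mono nhdsWithin_le_nhds

lemma eventually_hamiltonian_sub_rescaled_le (hm : 1 ≤ m) (hH0 : AssumptionH0 H)
    (hH1 : AssumptionH1 H m) {ρ η : ℝ} (hρ : 0 ≤ ρ) (hη : 0 < η) :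
    ∀ᶠ μ in 𝓝[<] (1 : ℝ), ∀ x p, ‖p‖ ≤ ρ → H x p - μ * H x (μ⁻¹ • p) ≤ η := by
  obtain ⟨C, hC⟩ := exists_hamiltonian_le hm hH0 hH1 (2 * ρ)
  have hinv : ContinuousAt (fun μ : ℝ => μ⁻¹) 1 := continuousAt_inv₀ one_ne_zero
  have hD : 0 < 1 + (2 * ρ) ^ m := by positivity
  obtain ⟨δ, hδ, -, hH1⟩ := hH1.exists_dist hm (show 0 < η / 2 / (1 + (2 * ρ) ^ m) by positivity)
  filter_upwards [eventually_nhdsLT_one_lt hinv (show (1 : ℝ)⁻¹ < 2 by norm_num),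
    eventually_nhdsLT_one_lt (f := fun μ => (μ⁻¹ - 1) * ρ) (by fun_prop) (by simpa using hδ),
    eventually_nhdsLT_one_lt (f := fun μ => (1 - μ) * C) (c := η / 2) (by fun_prop)
      (by simpa using hη),
    eventually_nhdsLT_one_lt (f := fun μ => -μ) (c := 0) (by fun_prop) (by norm_num),
    self_mem_nhdsWithin] with μ hμ2 hμδ hμC hμ0 hμ1 x p hp
  rw [neg_lt_zero] at hμ0
  have hμ1 : μ < 1 := hμ1
  have hinv1 : 1 ≤ μ⁻¹ := (one_le_inv₀ hμ0).2 hμ1.le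
  have hscaled : ‖μ⁻¹ • p‖ ≤ 2 * ρ := by
    rw [norm_smul, Real.norm_of_nonneg (by positivity)]
    gcongr
  have hdiff : ‖p - μ⁻¹ • p‖ < δ := by
    rw [norm_sub_rev, show μ⁻¹ • p - p = (μ⁻¹ - 1) • p by rw [sub_smul, one_smul], norm_smul,
      Real.norm_of_nonneg (sub_nonneg.2 hinv1)]
    exact (mul_le_mul_of_nonneg_left hp (sub_nonneg.2 hinv1)).trans_lt hμδ
  have hstep := hH1 x x (μ⁻¹ • p) (p - μ⁻¹ • p) (by simpa using hδ) hdiff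
  rw [add_sub_cancel] at hstep
  have hpow : η / 2 / (1 + (2 * ρ) ^ m) * (1 + ‖μ⁻¹ • p‖ ^ m) ≤ η / 2 := by
    calc _ ≤ η / 2 / (1 + (2 * ρ) ^ m) * (1 + (2 * ρ) ^ m) := by gcongr
      _ = η / 2 := div_mul_cancel₀ _ hD.ne'
  have hC' := mul_le_mul_of_nonneg_left (hC x _ hscaled) (sub_nonneg.2 hμ1.le)
  linarith

lemma exists_hamiltonian_gain (hm : 1 ≤ m) (hH0 : AssumptionH0 H) (hH1 : AssumptionH1 H m)
    (hH2 : AssumptionH2 H m) :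
    ∃ b > 0, ∀ η > 0, ∀ᶠ μ in 𝓝[<] (1 : ℝ), ∀ x p,
      H x p - μ * H x (μ⁻¹ • p) ≤ η - (1 - μ) * b * ‖p‖ ^ m := by
  obtain ⟨b, b₀, r₀, μ₀, hb, -, hr₀, -, hμ₀1, hgain⟩ := hH2
  refine ⟨b, hb, fun η hη => ?_⟩
  filter_upwards [eventually_hamiltonian_sub_rescaled_le hm hH0 hH1 hr₀.le (half_pos hη),
    eventually_nhdsLT_one_lt (f := fun μ => (1 - μ) * b₀) (c := η) (by fun_prop) (by simpa),
    eventually_nhdsLT_one_lt (f := fun μ => (1 - μ) * b * r₀ ^ m) (c := η / 2) (by fun_prop)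
      (by simpa),
    eventually_nhdsLT_one_lt (f := fun μ => -μ) (c := -μ₀) (by fun_prop) (neg_lt_neg hμ₀1),
    self_mem_nhdsWithin] with μ hsmall hμb₀ hμb hμ0 hμ1 x p
  have hμ1 : μ < 1 := hμ1
  rcases le_total r₀ ‖p‖ with hp | hp
  · have := hgain μ (neg_lt_neg_iff.1 hμ0).le hμ1.le x p hp
    linarith
  · have hpow : (1 - μ) * b * ‖p‖ ^ m ≤ (1 - μ) * b * r₀ ^ m := by
      have := sub_pos.2 hμ1
      gcongr
    linarith [hsmall x p hp]

-- Here the superlinear growth pays for the oscillation of `H` allowed by (H1), and what is left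
-- over still controls `‖p‖`.
theorem eventually_exists_hamiltonian_sub_le (hm : 1 ≤ m) (hH0 : AssumptionH0 H)
    (hH1 : AssumptionH1 H m) (hH2 : AssumptionH2 H m) {η : ℝ} (hη : 0 < η) :
    ∀ᶠ μ in 𝓝[<] (1 : ℝ), ∃ c > 0, ∃ δ > 0, ∀ x y p q, ‖x - y‖ < δ → ‖q‖ < δ →
      H y p - μ * H x (μ⁻¹ • (p + q)) ≤ η - c * (1 + ‖p‖) := by
  obtain ⟨b, hb, hgain⟩ := exists_hamiltonian_gain hm hH0 hH1 hH2
  filter_upwards [hgain (η / 3) (by positivity), self_mem_nhdsWithin] with μ hgain hμ1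
  have hμ : 0 < 1 - μ := sub_pos.2 hμ1
  set ε := min (η / 3) ((1 - μ) * b / 2)
  have hε : 0 < ε := by positivity
  have hεη : ε ≤ η / 3 := min_le_left _ _
  have hεb : 2 * ε ≤ (1 - μ) * b := by linarith [min_le_right (η / 3) ((1 - μ) * b / 2)]
  obtain ⟨δ, hδ, hδ1, hH1⟩ := hH1.exists_dist hm hε
  refine ⟨ε / 3, by positivity, δ, hδ, fun x y p q hxy hq => ?_⟩
  have hosc := hH1 x y (p + q) (-q) hxy (by rwa [norm_neg])
  rw [add_neg_cancel_right] at hosc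
  have hp : 1 + ‖p‖ ≤ 3 * (1 + ‖p + q‖ ^ m) := by
    have := norm_le_norm_add_norm_sub' p (p + q)
    have := self_le_one_add_rpow (norm_nonneg (p + q)) hm
    have : 0 ≤ ‖p + q‖ ^ m := by positivity
    rw [sub_add_cancel_left, norm_neg] at *
    linarith
  have hpε := mul_le_mul_of_nonneg_left hp hε.le
  have hpow := mul_le_mul_of_nonneg_right hεb (show 0 ≤ ‖p + q‖ ^ m by positivity)
  linarith [hgain x (p + q)]

end hamiltonian

/-! ### Doubling of variables -/

section rescaling

variable {lam : ℝ} {ν : Space N → Measure (Space N)} {H : Space N → Space N → ℝ}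
  {u : Space N → ℝ}

lemma levyOp_const_mul (c : ℝ) (ν : Space N → Measure (Space N)) (ξ : Space N) (A : Set (Space N))
    (x p : Space N) (u : Space N → ℝ) :
    levyOp ν ξ A x (c • p) (fun y => c * u y) = c * levyOp ν ξ A x p u := by
  rw [levyOp, levyOp, ← integral_const_mul]
  congr 1 with z
  by_cases hz : z ∈ ball (0 : Space N) 1 <;> simp [hz, inner_smul_left] <;> ring

lemma IsViscositySubsolution.const_mul (hu : IsViscositySubsolution lam ν H u) {c : ℝ}
    (hc : 0 < c) :
    IsViscositySubsolution lam ν (fun x p => c * H x (c⁻¹ • p)) (fun y => c * u y) := by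
  obtain ⟨husc, ⟨K, hK⟩, hu⟩ := hu
  refine ⟨(continuous_const_mul c).comp_upperSemicontinuous husc
    (monotone_mul_left_of_nonneg hc.le), ⟨c * K, fun y => ?_⟩, fun φ x δ hδ hφ hφb hmax => ?_⟩
  · rw [abs_mul, abs_of_pos hc]
    exact mul_le_mul_of_nonneg_left (hK y) hc.le
  obtain ⟨C, hC⟩ := hφb
  have hscaled := hu (fun y => c⁻¹ * φ y) x δ hδ (contDiffOn_const.mul hφ)
    ⟨c⁻¹ * C, fun y => by
      rw [abs_mul, abs_of_pos (inv_pos.2 hc)]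
      exact mul_le_mul_of_nonneg_left (hC y) (inv_pos.2 hc).le⟩ fun y hy => by
      have := mul_le_mul_of_nonneg_left (hmax y hy) (inv_pos.2 hc).le
      simpa only [mul_sub, inv_mul_cancel_left₀ hc.ne'] using this
  have hdiff : DifferentiableAt ℝ φ x :=
    (hφ.contDiffAt (ball_mem_nhds x hδ)).differentiableAt (by norm_num)
  have hgrad : gradient φ x = c • gradient (fun y => c⁻¹ * φ y) x := by
    rw [(hasGradientAt_const_mul c⁻¹ hdiff.hasGradientAt).gradient, smul_inv_smul₀ hc.ne']
  have hop := levyOp_const_mul c ν x (ball 0 δ) x (gradient (fun y => c⁻¹ * φ y) x)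
    fun y => c⁻¹ * φ y
  simp only [mul_inv_cancel_left₀ hc.ne'] at hop
  calc viscExpr lam ν (fun x p => c * H x (c⁻¹ • p)) (fun y => c * u y) φ x δ
      = c * viscExpr lam ν H u (fun y => c⁻¹ * φ y) x δ := by
        rw [viscExpr, viscExpr, hgrad, inv_smul_smul₀ hc.ne', hop, levyOp_const_mul]
        ring
    _ ≤ 0 := mul_nonpos_of_nonneg_of_nonpos hc.le hscaled

lemma IsViscositySupersolution.le_residual {x : Space N} {φ : Space N → ℝ}
    (hν : ∀ ξ, IsLevyMeasure (ν ξ)) (hu : IsViscositySupersolution lam ν H u)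
    (hφ : ContDiffAt ℝ 2 φ x) (hmin : IsLocalMin (fun y => u y - φ y) x) :
    Integrable (levyIntegrand u x (gradient φ x)) (ν x) ∧
      0 ≤ residual lam ν H u x (gradient φ x) := by
  obtain ⟨hinteg, hres⟩ := (isViscositySupersolution_iff_neg.1 hu).residual_le hν hφ.neg
    (hmin.neg.congr (Eventually.of_forall fun y => by simp; ring))
  rw [gradient_neg, residual_neg] at *
  exact ⟨hinteg.neg.congr (Eventually.of_forall fun z => by simp [levyIntegrand_neg]),
    neg_nonpos.1 hres⟩

end rescaling

section doubling

/-- The doubled functional: its maximum points `(x, y)` play the role of a maximum point of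
`u - v`, the penalisation by `b` making the maximum attained. -/
noncomputable def doubling (u v : Space N → ℝ) (α b : ℝ) (x y : Space N) : ℝ :=
  u x - v y - α * ‖x - y‖ ^ 2 - b * japaneseBracket x

lemma exists_forall_le_of_isBounded_superlevel {X : Type*} [PseudoMetricSpace X] [ProperSpace X]
    {f : X → ℝ} (hf : UpperSemicontinuous f) (x₀ : X)
    (hb : Bornology.IsBounded {x | f x₀ ≤ f x}) : ∃ x, ∀ y, f y ≤ f x := by
  have hcpt : IsCompact {x | f x₀ ≤ f x} :=
    Metric.isCompact_of_isClosed_isBounded (hf.isClosed_preimage (f x₀)) hb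
  obtain ⟨x, hx, hmax⟩ := (hf.upperSemicontinuousOn _).exists_isMaxOn ⟨x₀, le_refl (f x₀)⟩ hcpt
  exact ⟨x, fun y => (le_total (f x₀) (f y)).elim (fun h => hmax h) fun h => h.trans hx⟩

variable {lam : ℝ} {ν : Space N → Measure (Space N)} {H₁ H₂ : Space N → Space N → ℝ}
  {u v : Space N → ℝ} {K α b : ℝ} {x y : Space N}

lemma exists_forall_doubling_le (hu : UpperSemicontinuous u) (hv : LowerSemicontinuous v)
    (huK : ∀ x, |u x| ≤ K) (hvK : ∀ x, |v x| ≤ K) (hα : 0 < α) (hb : 0 < b) :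
    ∃ x y, ∀ x' y', doubling u v α b x' y' ≤ doubling u v α b x y := by
  have husc : UpperSemicontinuous fun q : Space N × Space N => doubling u v α b q.1 q.2 := by
    have hpen : Continuous fun q : Space N × Space N =>
        -(α * ‖q.1 - q.2‖ ^ 2) + -(b * japaneseBracket q.1) := by
      have := (contDiff_japaneseBracket (E := Space N) (n := 0)).continuous
      fun_prop
    have hneg : UpperSemicontinuous fun y => -v y :=
      continuous_neg.comp_lowerSemicontinuous_antitone hv fun _ _ => neg_le_neg
    have hsum := ((hu.comp continuous_fst).add (hneg.comp continuous_snd)).add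
      hpen.upperSemicontinuous
    simpa only [doubling, Function.comp_apply, sub_eq_add_neg, add_assoc] using hsum
  suffices hbdd : Bornology.IsBounded
      {q : Space N × Space N | doubling u v α b 0 0 ≤ doubling u v α b q.1 q.2} by
    obtain ⟨q, hq⟩ := exists_forall_le_of_isBounded_superlevel husc 0 hbdd
    exact ⟨q.1, q.2, fun x' y' => hq (x', y')⟩
  set A := 2 * K - doubling u v α b 0 0
  refine isBounded_iff_forall_norm_le.2 ⟨A / b + √(A / α), fun q hq => ?_⟩
  have hq : doubling u v α b 0 0 ≤ doubling u v α b q.1 q.2 := hq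
  have hA : α * ‖q.1 - q.2‖ ^ 2 + b * japaneseBracket q.1 ≤ A := by
    unfold doubling at hq
    simp only [A, doubling]
    linarith [(abs_le.1 (huK q.1)).2, (abs_le.1 (hvK q.2)).1]
  have hfst : ‖q.1‖ ≤ A / b := by
    rw [le_div_iff₀' hb]
    have := mul_le_mul_of_nonneg_left (norm_le_japaneseBracket q.1) hb.le
    linarith [show 0 ≤ α * ‖q.1 - q.2‖ ^ 2 by positivity]
  have hdiff : ‖q.1 - q.2‖ ≤ √(A / α) := by
    refine Real.le_sqrt_of_sq_le ((le_div_iff₀' hα).2 ?_)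
    have := one_le_japaneseBracket q.1
    linarith [show 0 ≤ b * japaneseBracket q.1 by positivity]
  have hsnd := norm_le_norm_add_norm_sub q.1 q.2
  refine max_le ?_ ?_ <;> linarith [Real.sqrt_nonneg (A / α)]

section maximum

variable (hmax : ∀ x' y', doubling u v α b x' y' ≤ doubling u v α b x y)
include hmax

lemma residual_le_of_doubling_max (hν : ∀ ξ, IsLevyMeasure (ν ξ))
    (hu : IsViscositySubsolution lam ν H₁ u) :
    Integrable (levyIntegrand u x ((2 * α) • (x - y) + b • (japaneseBracket x)⁻¹ • x)) (ν x) ∧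
      residual lam ν H₁ u x ((2 * α) • (x - y) + b • (japaneseBracket x)⁻¹ • x) ≤ 0 := by
  have hgrad := hasGradientAt_add (hasGradientAt_const_mul α (hasGradientAt_norm_sub_sq y x))
    (hasGradientAt_const_mul b (hasGradientAt_japaneseBracket x))
  have hC2 : ContDiff ℝ 2 fun x' => α * ‖x' - y‖ ^ 2 + b * japaneseBracket x' :=
    (contDiff_const.mul ((contDiff_id.sub contDiff_const).norm_sq ℝ)).add
      (contDiff_const.mul contDiff_japaneseBracket)
  have hres := hu.residual_le hν hC2.contDiffAt (x := x) <| Eventually.of_forall fun x' => by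
    have := hmax x' y
    unfold doubling at this
    linarith
  rwa [hgrad.gradient, smul_smul, mul_comm α] at hres

lemma le_residual_of_doubling_max (hν : ∀ ξ, IsLevyMeasure (ν ξ))
    (hv : IsViscositySupersolution lam ν H₂ v) :
    Integrable (levyIntegrand v y ((2 * α) • (x - y))) (ν y) ∧
      0 ≤ residual lam ν H₂ v y ((2 * α) • (x - y)) := by
  have hgrad := hasGradientAt_const_mul (-α) (hasGradientAt_norm_sub_sq x y)
  have hC2 : ContDiff ℝ 2 fun y' => -α * ‖y' - x‖ ^ 2 :=
    contDiff_const.mul ((contDiff_id.sub contDiff_const).norm_sq ℝ)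
  have hres := hv.le_residual hν hC2.contDiffAt (x := y) <| Eventually.of_forall fun y' => by
    have := hmax x y'
    unfold doubling at this
    rw [norm_sub_rev x y, norm_sub_rev x y'] at this
    linarith
  have hp : -α • (2 : ℝ) • (y - x) = (2 * α) • (x - y) := by
    rw [smul_smul, ← neg_sub x y, smul_neg, ← neg_smul]; ring_nf
  rwa [hgrad.gradient, hp] at hres

lemma levyIntegrand_sub_le_of_norm_lt {z₁ z₂ : Space N} (hb : 0 ≤ b) (hz₁ : ‖z₁‖ < 1)
    (hz₂ : ‖z₂‖ < 1) :
    levyIntegrand u x ((2 * α) • (x - y) + b • (japaneseBracket x)⁻¹ • x) z₁ -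
      levyIntegrand v y ((2 * α) • (x - y)) z₂ ≤ α * ‖z₁ - z₂‖ ^ 2 + b * ‖z₁‖ ^ 2 := by
  have hsq : ‖x + z₁ - (y + z₂)‖ ^ 2 =
      ‖x - y‖ ^ 2 + 2 * inner ℝ (x - y) (z₁ - z₂) + ‖z₁ - z₂‖ ^ 2 := by
    rw [add_sub_add_comm, norm_add_sq_real]
  have hbracket := mul_le_mul_of_nonneg_left (japaneseBracket_add_sub_inner_le x z₁) hb
  have := hmax (x + z₁) (y + z₂)
  rw [doubling, doubling, hsq, inner_sub_right] at this
  rw [levyIntegrand_of_norm_lt hz₁, levyIntegrand_of_norm_lt hz₂]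
  simp only [inner_add_left, real_inner_smul_left] at *
  linarith

lemma levyIntegrand_sub_le (hb : 0 ≤ b) (z : Space N) :
    levyIntegrand u x ((2 * α) • (x - y) + b • (japaneseBracket x)⁻¹ • x) z -
      levyIntegrand v y ((2 * α) • (x - y)) z ≤ b * ‖z‖ := by
  rcases lt_or_ge ‖z‖ 1 with hz | hz
  · have := levyIntegrand_sub_le_of_norm_lt hmax hb hz hz
    rw [sub_self, norm_zero] at this
    nlinarith [mul_le_mul_of_nonneg_left hz.le (mul_nonneg hb (norm_nonneg z))]
  · have := hmax (x + z) (y + z)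
    rw [doubling, doubling, add_sub_add_right_eq_sub] at this
    have hbracket := mul_le_mul_of_nonneg_left (japaneseBracket_add_le x z) hb
    have hz' : z ∉ ball (0 : Space N) 1 := by simpa using hz
    rw [levyIntegrand, levyIntegrand, Set.indicator_of_notMem hz', Set.indicator_of_notMem hz']
    linarith

end maximum

end doubling

/-! ### Comparison -/

section integrals

variable {ν₁ ν₂ : Measure (Space N)} {f g : Space N → ℝ} {α b r R τ L M : ℝ}

lemma setIntegral_ball_sub_le {γ : Measure (Space N × Space N)} (hν : IsLevyMeasure ν₁)
    (hf : Measurable f) (hf0 : f 0 = 0) (hfi : Integrable f ν₁) (hg : Measurable g) (hg0 : g 0 = 0)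
    (hgi : Integrable g ν₂) (hb : 0 ≤ b)
    (hfg : ∀ z₁ z₂, ‖z₁‖ < 1 → ‖z₂‖ < 1 → f z₁ - g z₂ ≤ α * ‖z₁ - z₂‖ ^ 2 + b * ‖z₁‖ ^ 2)
    (hr : r ≤ 1)
    (hγ : γ ∈ Admissible (ball 0 r) (ν₁.restrict (ball 0 r)) (ν₂.restrict (ball 0 r)))
    (hγi : Integrable (fun z : Space N × Space N => ‖z.1 - z.2‖ ^ 2) γ) :
    ∫ z in ball 0 r, f z ∂ν₁ - ∫ z in ball 0 r, g z ∂ν₂ ≤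
      α * ∫ z, ‖z.1 - z.2‖ ^ 2 ∂γ + b * ∫ z, levyWeight z ∂ν₁ := by
  have hwi : Integrable (fun z => b * levyWeight z) ν₁ := hν.integrable_levyWeight.const_mul b
  have hcoupling := Admissible.integral_sub_integral_le hγ measurableSet_ball
    (f := fun z => f z - b * levyWeight z)
    (hf.sub (continuous_levyWeight.measurable.const_mul b)) (by simp [hf0])
    (hfi.sub hwi).integrableOn hg hg0 hgi.integrableOn (hγi.const_mul α)
    fun z₁ hz₁ z₂ hz₂ => by
      have hz₁' : ‖z₁‖ < 1 := (mem_ball_zero_iff.1 hz₁).trans_le hr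
      have := hfg z₁ z₂ hz₁' ((mem_ball_zero_iff.1 hz₂).trans_le hr)
      rw [levyWeight_of_norm_le_one hz₁'.le]
      linarith
  rw [integral_sub hfi.integrableOn hwi.integrableOn, integral_const_mul, integral_const_mul]
    at hcoupling
  have := mul_le_mul_of_nonneg_left (setIntegral_le_integral (s := ball 0 r)
    hν.integrable_levyWeight (Eventually.of_forall levyWeight_nonneg)) hb
  linarith

lemma setIntegral_annulus_sub_le (hν₁ : IsLevyMeasure ν₁) (hν₂ : IsLevyMeasure ν₂)
    (hfi : Integrable f ν₁) (hg : Measurable g) (hgL : ∀ z, |g z| ≤ L) (hb : 0 ≤ b) (hR : 0 ≤ R)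
    (hfg : ∀ z, f z - g z ≤ b * ‖z‖) (hr : 0 < r) (hr1 : r ≤ 1) (hτ0 : 0 ≤ τ)
    (hτ : totalVar ν₁ ν₂ (ball 0 R \ ball 0 r) ≤ ENNReal.ofReal τ) :
    ∫ z in ball 0 R \ ball 0 r, f z ∂ν₁ - ∫ z in ball 0 R \ ball 0 r, g z ∂ν₂ ≤
      b * R * ((∫ z, levyWeight z ∂ν₁) / r ^ 2) + L * τ := by
  set A : Set (Space N) := ball 0 R \ ball 0 r
  have hA : MeasurableSet A := measurableSet_ball.diff measurableSet_ball
  have hAr : A ⊆ (ball 0 r)ᶜ := Set.sdiff_subset_compl _ _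
  have h₁ : ν₁ A ≠ ∞ := measure_ne_top_of_subset hAr (hν₁.measure_compl_ball_ne_top hr)
  have h₂ : ν₂ A ≠ ∞ := measure_ne_top_of_subset hAr (hν₂.measure_compl_ball_ne_top hr)
  have hgi : IntegrableOn g A ν₁ := integrableOn_of_abs_le hA h₁ hg fun z _ => hgL z
  have hvar := setIntegral_sub_le_totalVar hA h₁ h₂ hg ((abs_nonneg _).trans (hgL 0)) hτ0
    (fun z _ => hgL z) hτ
  have hmass : ν₁.real A ≤ (∫ z, levyWeight z ∂ν₁) / r ^ 2 :=
    (le_div_iff₀' (by positivity)).2 (hν₁.sq_mul_measureReal_le hr hr1 hAr)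
  have hdiff : ∫ z in A, f z ∂ν₁ - ∫ z in A, g z ∂ν₁ ≤ b * R * ν₁.real A := by
    rw [← integral_sub hfi.integrableOn hgi]
    calc ∫ z in A, f z - g z ∂ν₁ ≤ ∫ _ in A, b * R ∂ν₁ :=
          setIntegral_mono_on (hfi.integrableOn.sub hgi) (integrableOn_const h₁) hA fun z hz =>
            (hfg z).trans (mul_le_mul_of_nonneg_left (mem_ball_zero_iff.1 hz.1).le hb)
      _ = b * R * ν₁.real A := by rw [setIntegral_const, smul_eq_mul, mul_comm]
  linarith [mul_le_mul_of_nonneg_left hmass (mul_nonneg hb hR)]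

lemma abs_setIntegral_compl_ball_le (hν : IsLevyMeasure ν₁) (hR : 1 ≤ R) (hM : 0 ≤ M)
    (hfM : ∀ z, 1 ≤ ‖z‖ → |f z| ≤ M) (hτ : ν₁.real (ball 0 R)ᶜ ≤ τ) :
    |∫ z in (ball 0 R)ᶜ, f z ∂ν₁| ≤ M * τ :=
  (norm_setIntegral_le_of_norm_le_const (f := f)
    (hν.measure_compl_ball_ne_top (one_pos.trans_le hR)).lt_top fun z hz =>
      hfM z (hR.trans (by simpa using hz))).trans (mul_le_mul_of_nonneg_left hτ hM)

end integrals

section comparison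

variable {lam : ℝ} {ν : Space N → Measure (Space N)} {H H₁ H₂ : Space N → Space N → ℝ}
  {u v : Space N → ℝ} {K c : ℝ}

lemma abs_levyIntegrand_le_of_one_le_norm (hu : ∀ y, |u y| ≤ K) (x p : Space N) {z : Space N}
    (hz : 1 ≤ ‖z‖) : |levyIntegrand u x p z| ≤ 2 * K := by
  rw [levyIntegrand, Set.indicator_of_notMem (by simpa using hz), sub_zero]
  linarith [abs_sub (u (x + z)) (u x), hu (x + z), hu x]

lemma integral_levyIntegrand_sub_le {α b : ℝ} {x y : Space N}
    (hmax : ∀ x' y', doubling u v α b x' y' ≤ doubling u v α b x y) (hb : 0 ≤ b)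
    (hν : ∀ ξ, IsLevyMeasure (ν ξ)) (hu : Measurable u) (hv : Measurable v)
    (huK : ∀ x, |u x| ≤ K) (hvK : ∀ x, |v x| ≤ K) {p q : Space N} (hp : p = (2 * α) • (x - y))
    (hq : q = p + b • (japaneseBracket x)⁻¹ • x) (hi₁ : Integrable (levyIntegrand u x q) (ν x))
    (hi₂ : Integrable (levyIntegrand v y p) (ν y)) {C r R τ : ℝ}
    (hC : ∫ z, levyWeight z ∂(ν x) ≤ C) (hr : 0 < r) (hr1 : r ≤ 1) (hR : 1 ≤ R) (hτ0 : 0 ≤ τ)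
    {γ : Measure (Space N × Space N)}
    (hγ : γ ∈ Admissible (ball 0 r) ((ν x).restrict (ball 0 r)) ((ν y).restrict (ball 0 r)))
    (hγi : Integrable (fun z : Space N × Space N => ‖z.1 - z.2‖ ^ 2) γ)
    (hτ : totalVar (ν x) (ν y) (ball 0 R \ ball 0 r) ≤ ENNReal.ofReal τ)
    (hτx : (ν x).real (ball 0 R)ᶜ ≤ τ) (hτy : (ν y).real (ball 0 R)ᶜ ≤ τ) :
    ∫ z, levyIntegrand u x q z ∂(ν x) - ∫ z, levyIntegrand v y p z ∂(ν y) ≤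
      α * ∫ z, ‖z.1 - z.2‖ ^ 2 ∂γ + b * (C + R * (C / r ^ 2)) + (6 * K + ‖p‖) * τ := by
  have hK : 0 ≤ K := (abs_nonneg _).trans (huK 0)
  have hball := setIntegral_ball_sub_le (hν x) (measurable_levyIntegrand hu)
    (levyIntegrand_zero _ _ _) hi₁ (measurable_levyIntegrand hv) (levyIntegrand_zero _ _ _) hi₂ hb
    (by rw [hq, hp]; exact fun z₁ z₂ => levyIntegrand_sub_le_of_norm_lt hmax hb) hr1 hγ hγi
  have hannulus := setIntegral_annulus_sub_le (hν x) (hν y) hi₁ (measurable_levyIntegrand hv)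
    (abs_levyIntegrand_le hvK y p) hb (by positivity)
    (by rw [hq, hp]; exact levyIntegrand_sub_le hmax hb) hr hr1 hτ0 hτ
  have hfar₁ := abs_setIntegral_compl_ball_le (hν x) hR (by positivity)
    (fun z => abs_levyIntegrand_le_of_one_le_norm huK x q) hτx
  have hfar₂ := abs_setIntegral_compl_ball_le (hν y) hR (by positivity)
    (fun z => abs_levyIntegrand_le_of_one_le_norm hvK y p) hτy
  have hbC := mul_le_mul_of_nonneg_left hC hb
  have hbRC : b * R * ((∫ z, levyWeight z ∂(ν x)) / r ^ 2) ≤ b * R * (C / r ^ 2) := by gcongr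
  rw [integral_eq_ball_add_annulus_add_compl hi₁ (hr1.trans hR),
    integral_eq_ball_add_annulus_add_compl hi₂ (hr1.trans hR)]
  linarith [(abs_le.1 hfar₁).2, (abs_le.1 hfar₂).1]

lemma exists_integral_levyIntegrand_sub_le (hν : ∀ ξ, IsLevyMeasure (ν ξ)) (hM1 : AssumptionM1 ν)
    (hM2 : AssumptionM2 ν) (hM3 : AssumptionM3 ν) (hM4 : AssumptionM4 ν) (hu : Measurable u)
    (hv : Measurable v) (huK : ∀ x, |u x| ≤ K) (hvK : ∀ x, |v x| ≤ K) (hc : 0 < c) :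
    ∃ s > 0, ∃ β > 0, ∀ α > 0, ∀ b ≥ 0, b ≤ β → ∀ x y p q, p = (2 * α) • (x - y) →
      q = p + b • (japaneseBracket x)⁻¹ • x →
      (∀ x' y', doubling u v α b x' y' ≤ doubling u v α b x y) → ‖x - y‖ < s →
      Integrable (levyIntegrand u x q) (ν x) → Integrable (levyIntegrand v y p) (ν y) →
      ∫ z, levyIntegrand u x q z ∂(ν x) - ∫ z, levyIntegrand v y p z ∂(ν y) ≤ c * (1 + ‖p‖) := by
  have hK : 0 ≤ K := (abs_nonneg _).trans (huK 0)
  obtain ⟨C, hC, hM1⟩ := hM1.exists_bound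
  obtain ⟨ρ, hρ, hρ1, hM4⟩ := hM4.exists_radius (half_pos hc)
  obtain ⟨r, hr, hrρ⟩ := exists_between hρ
  set τ := c / (24 * (K + 1)) with hτ
  have hτ0 : 0 < τ := by positivity
  have hKτ : 24 * (K * τ) + 24 * τ = c := by rw [hτ]; field_simp
  obtain ⟨R, hR, hM2⟩ := hM2.exists_radius hτ0
  obtain ⟨s, hs, hM3⟩ := hM3.exists_dist hr (by linarith : r < R) hτ0
  have : 0 < C + R * (C / r ^ 2) := by positivity
  refine ⟨s, hs, c / (4 * (C + R * (C / r ^ 2))), by positivity,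
    fun α hα b hb hbβ x y p q hp hq hmax hxy hi₁ hi₂ => ?_⟩
  obtain ⟨γ, hγ, hγi, hγle⟩ := hM4 r hr hrρ x y (c / (4 * α)) (by positivity)
  have hsplit := integral_levyIntegrand_sub_le hmax hb hν hu hv huK hvK hp hq hi₁ hi₂ (hM1 x) hr
    (hrρ.trans hρ1).le hR.le hτ0.le hγ hγi (hM3 x y hxy) (hM2 x) (hM2 y)
  have hnear : α * ∫ z, ‖z.1 - z.2‖ ^ 2 ∂γ ≤ c / 4 * ‖p‖ + c / 4 := by
    calc α * ∫ z, ‖z.1 - z.2‖ ^ 2 ∂γ ≤ α * (c / 2 * ‖x - y‖ + c / (4 * α)) := by gcongr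
      _ = c / 4 * (2 * α * ‖x - y‖) + c / 4 := by field_simp; ring
      _ = c / 4 * ‖p‖ + c / 4 := by rw [hp, norm_smul, Real.norm_of_nonneg (by positivity)]
  have hbracket : b * (C + R * (C / r ^ 2)) ≤ c / 4 := by
    rw [le_div_iff₀ (by positivity)] at hbβ
    linarith
  have hvar : (6 * K + ‖p‖) * τ ≤ c / 4 + c / 4 * ‖p‖ := by
    have hτc : τ ≤ c / 4 := by linarith [mul_nonneg hK hτ0.le]
    linarith [mul_le_mul_of_nonneg_right hτc (norm_nonneg p)]
  linarith [mul_nonneg hc.le (norm_nonneg p)]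

lemma exists_doubling_max (hu : UpperSemicontinuous u) (hv : LowerSemicontinuous v)
    (huK : ∀ x, |u x| ≤ K) (hvK : ∀ x, |v x| ≤ K) (x₀ : Space N) {s β θ : ℝ} (hs : 0 < s)
    (hβ : 0 < β) (hθ : 0 < θ) :
    ∃ α > 0, ∃ b > 0, b ≤ β ∧ ∃ x y,
      (∀ x' y', doubling u v α b x' y' ≤ doubling u v α b x y) ∧ ‖x - y‖ < s ∧
        u x₀ - v x₀ - θ ≤ u x - v y := by
  have hK : 0 ≤ K := (abs_nonneg _).trans (huK 0)
  have hx₀ := one_le_japaneseBracket x₀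
  set α := (4 * K + θ + 1) / s ^ 2
  set b := min β (θ / japaneseBracket x₀)
  have hα : 0 < α := by positivity
  have hb : 0 < b := by positivity
  have hbθ : b * japaneseBracket x₀ ≤ θ := (le_div_iff₀ (by positivity)).1 (min_le_right _ _)
  obtain ⟨x, y, hmax⟩ := exists_forall_doubling_le hu hv huK hvK hα hb
  have hx := one_le_japaneseBracket x
  have hbx : 0 ≤ b * japaneseBracket x := by positivity
  have hαxy : 0 ≤ α * ‖x - y‖ ^ 2 := by positivity
  have h₀ : u x₀ - v x₀ - b * japaneseBracket x₀ ≤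
      u x - v y - α * ‖x - y‖ ^ 2 - b * japaneseBracket x := by
    simpa [doubling] using hmax x₀ x₀
  refine ⟨α, hα, b, hb, min_le_left _ _, x, y, hmax, ?_, by linarith⟩
  have hαs : α * s ^ 2 = 4 * K + θ + 1 := div_mul_cancel₀ _ (by positivity)
  have hlt : α * ‖x - y‖ ^ 2 < α * s ^ 2 := by
    linarith [abs_le.1 (huK x₀), abs_le.1 (hvK x₀), abs_le.1 (huK x), abs_le.1 (hvK y)]
  exact lt_of_pow_lt_pow_left₀ 2 hs.le (lt_of_mul_lt_mul_left hlt hα.le)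

lemma mul_sub_le_of_hamiltonian_sub_le (hlam : 0 < lam) (hν : ∀ ξ, IsLevyMeasure (ν ξ))
    (hM1 : AssumptionM1 ν) (hM2 : AssumptionM2 ν) (hM3 : AssumptionM3 ν) (hM4 : AssumptionM4 ν)
    (hu : IsViscositySubsolution lam ν H₁ u) (hv : IsViscositySupersolution lam ν H₂ v)
    {η δ : ℝ} (hc : 0 < c) (hδ : 0 < δ)
    (hH : ∀ x y p q, ‖x - y‖ < δ → ‖q‖ < δ → H₂ y p - H₁ x (p + q) ≤ η - c * (1 + ‖p‖))
    (x₀ : Space N) : lam * (u x₀ - v x₀) ≤ η := by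
  obtain ⟨K₁, hK₁⟩ := hu.2.1
  obtain ⟨K₂, hK₂⟩ := hv.2.1
  have huK : ∀ x, |u x| ≤ max K₁ K₂ := fun x => (hK₁ x).trans (le_max_left _ _)
  have hvK : ∀ x, |v x| ≤ max K₁ K₂ := fun x => (hK₂ x).trans (le_max_right _ _)
  obtain ⟨s, hs, β, hβ, hnonlocal⟩ := exists_integral_levyIntegrand_sub_le hν hM1 hM2 hM3 hM4
    hu.1.measurable hv.1.measurable huK hvK hc
  refine le_of_forall_pos_le_add fun ε hε => ?_
  obtain ⟨α, hα, b, hb, hbβ, x, y, hmax, hxy, hle⟩ := exists_doubling_max hu.1 hv.1 huK hvK x₀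
    (lt_min hs hδ) (lt_min hβ (half_pos hδ)) (div_pos hε hlam)
  obtain ⟨hi₁, hres₁⟩ := residual_le_of_doubling_max hmax hν hu
  obtain ⟨hi₂, hres₂⟩ := le_residual_of_doubling_max hmax hν hv
  have hbracket : ‖b • (japaneseBracket x)⁻¹ • x‖ < δ := by
    rw [norm_smul, Real.norm_of_nonneg hb.le]
    have := mul_le_mul_of_nonneg_left (norm_inv_japaneseBracket_smul_le x) hb.le
    linarith [hbβ.trans (min_le_right _ _)]
  have hgain := hH x y ((2 * α) • (x - y)) _ (hxy.trans_le (min_le_right _ _)) hbracket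
  have herror := hnonlocal α hα b hb.le (hbβ.trans (min_le_left _ _)) x y _ _ rfl rfl hmax
    (hxy.trans_le (min_le_left _ _)) hi₁ hi₂
  have hscaled := mul_le_mul_of_nonneg_left hle hlam.le
  rw [mul_sub, mul_div_cancel₀ _ hlam.ne'] at hscaled
  unfold residual at hres₁ hres₂
  linarith

theorem comparison (hlam : 0 < lam) (hν : ∀ ξ, IsLevyMeasure (ν ξ)) (hM1 : AssumptionM1 ν)
    (hM2 : AssumptionM2 ν) (hM3 : AssumptionM3 ν) (hM4 : AssumptionM4 ν) {m : ℝ} (hm : 1 < m)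
    (hH0 : AssumptionH0 H) (hH1 : AssumptionH1 H m) (hH2 : AssumptionH2 H m)
    (hu : IsViscositySubsolution lam ν H u) (hv : IsViscositySupersolution lam ν H v)
    (x : Space N) : u x ≤ v x := by
  refine sub_nonpos.1 (nonpos_of_mul_nonpos_right (le_of_forall_pos_le_add fun η hη => ?_) hlam)
  have hscaled : ∀ᶠ μ in 𝓝[<] (1 : ℝ), lam * (μ * u x - v x) ≤ η := by
    filter_upwards [eventually_exists_hamiltonian_sub_le hm.le hH0 hH1 hH2 hη,
      Ioo_mem_nhdsLT zero_lt_one] with μ ⟨c, hc, δ, hδ, hH⟩ hμ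
    exact mul_sub_le_of_hamiltonian_sub_le hlam hν hM1 hM2 hM3 hM4 (hu.const_mul hμ.1) hv hc hδ
      hH x
  have hlim : Tendsto (fun μ => lam * (μ * u x - v x)) (𝓝[<] 1) (𝓝 (lam * (1 * u x - v x))) :=
    tendsto_nhdsWithin_of_tendsto_nhds (Continuous.tendsto (by fun_prop) 1)
  rw [one_mul] at hlim
  rw [zero_add]
  exact le_of_tendsto hlim hscaled

end comparison

/-! ### Existence -/

section existence

variable {lam : ℝ} {ν : Space N → Measure (Space N)} {H : Space N → Space N → ℝ}

theorem exists_greatest_subsolution (hν : ∀ ξ, IsLevyMeasure (ν ξ)) (hM2 : AssumptionM2 ν)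
    (hM3 : AssumptionM3 ν) (hM4 : AssumptionM4 ν)
    (hH : Continuous fun q : Space N × Space N => H q.1 q.2) {w₀ : Space N → ℝ}
    (hw₀ : IsViscositySubsolution lam ν H w₀) {K : ℝ}
    (hK : ∀ w, IsViscositySubsolution lam ν H w → ∀ x, w x ≤ K) :
    ∃ u, IsGreatest {w | IsViscositySubsolution lam ν H w} u := by
  set S := {w | IsViscositySubsolution lam ν H w}
  set U : Space N → ℝ := fun x => ⨆ w : S, w.1 x
  have : Nonempty S := ⟨⟨w₀, hw₀⟩⟩
  have hle : ∀ w ∈ S, ∀ x, w x ≤ U x := fun w hw x =>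
    le_ciSup (f := fun w : S => w.1 x) ⟨K, by rintro _ ⟨w, rfl⟩; exact hK w.1 w.2 x⟩ ⟨w, hw⟩
  obtain ⟨K₀, hK₀⟩ := hw₀.2.1
  have hUb : ∀ x, |U x| ≤ max K₀ K := fun x => by
    refine abs_le.2 ⟨?_, (ciSup_le fun w : S => hK w.1 w.2 x).trans (le_max_right _ _)⟩
    linarith [hle w₀ hw₀ x, (abs_le.1 (hK₀ x)).1, le_max_left K₀ K]
  have hsub : upperEnvelope U ∈ S := by
    refine isViscositySubsolution_of_frequently hν hM2 hM3 hM4 hH (fun w hw => hw)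
      (upperSemicontinuous_upperEnvelope hUb) ⟨_, abs_upperEnvelope_le hUb⟩
      (fun w hw y => (hle w hw y).trans (le_upperEnvelope hUb y)) fun x c hc => ?_
    refine (frequently_lt_of_lt_upperEnvelope hUb hc).mono fun y hy => ?_
    obtain ⟨w, hw⟩ := exists_lt_of_lt_ciSup (f := fun w : S => w.1 y) hy
    exact ⟨w.1, w.2, hw⟩
  exact ⟨_, hsub, fun w hw y => (hle w hw y).trans (le_upperEnvelope hUb y)⟩

theorem isViscositySolution_of_isGreatest (hlam : 0 < lam) (hν : ∀ ξ, IsLevyMeasure (ν ξ))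
    (hM1 : AssumptionM1 ν) (hM2 : AssumptionM2 ν) (hM3 : AssumptionM3 ν) (hM4 : AssumptionM4 ν)
    {m : ℝ} (hm : 1 < m) (hH0 : AssumptionH0 H) (hH1 : AssumptionH1 H m) (hH2 : AssumptionH2 H m)
    {u : Space N → ℝ} (hu : IsGreatest {w | IsViscositySubsolution lam ν H w} u) :
    IsViscositySolution lam ν H u := by
  have hsub : IsViscositySubsolution lam ν H u := hu.1
  obtain ⟨K, hK⟩ := isBddFun_neg hsub.2.1
  have henv : IsViscositySupersolution lam ν H (-upperEnvelope (-u)) := by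
    refine isViscositySupersolution_iff_neg.2 ?_
    have := isViscositySubsolution_upperEnvelope_neg hν hM2 hM3 hM4 hH0.1 hsub
      fun w hw _ y => hu.2 hw y
    simpa only [Pi.neg_apply, neg_neg] using this
  have hu_eq : -upperEnvelope (-u) = u := funext fun x =>
    le_antisymm (neg_le.1 (le_upperEnvelope hK x))
      (comparison hlam hν hM1 hM2 hM3 hM4 hm hH0 hH1 hH2 hsub henv x)
  rw [hu_eq] at henv
  exact ⟨continuous_iff_lower_upperSemicontinuous.2 ⟨henv.1, hsub.1⟩, hsub.2.1, hsub, henv⟩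

theorem exists_isViscositySolution (hlam : 0 < lam) (hν : ∀ ξ, IsLevyMeasure (ν ξ))
    (hM1 : AssumptionM1 ν) (hM2 : AssumptionM2 ν) (hM3 : AssumptionM3 ν) (hM4 : AssumptionM4 ν)
    {m : ℝ} (hm : 1 < m) (hH0 : AssumptionH0 H) (hH1 : AssumptionH1 H m)
    (hH2 : AssumptionH2 H m) : ∃ u, IsViscositySolution lam ν H u := by
  obtain ⟨C, hC⟩ := hH0.2
  have hlamC : lam * (C / lam) = C := mul_div_cancel₀ C hlam.ne'
  have hsub : IsViscositySubsolution lam ν H fun _ => -(C / lam) :=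
    isViscositySubsolution_const hν fun x => by
      rw [mul_neg, hlamC]
      linarith [(abs_le.1 (hC x)).2]
  have hsup : IsViscositySupersolution lam ν H fun _ => C / lam :=
    isViscositySupersolution_const hν fun x => by
      rw [hlamC]
      linarith [(abs_le.1 (hC x)).1]
  obtain ⟨u, hu⟩ := exists_greatest_subsolution hν hM2 hM3 hM4 hH0.1 hsub fun w hw =>
    comparison hlam hν hM1 hM2 hM3 hM4 hm hH0 hH1 hH2 hw hsup
  exact ⟨u, isViscositySolution_of_isGreatest hlam hν hM1 hM2 hM3 hM4 hm hH0 hH1 hH2 hu⟩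

end existence

end NonlocalHJ

theorem theorem2p2 {N : ℕ} (lam : ℝ) (hlam : 0 < lam)
    (ν : NonlocalHJ.Space N → Measure (NonlocalHJ.Space N))
    (hν : ∀ ξ, NonlocalHJ.IsLevyMeasure (ν ξ))
    (hM1 : NonlocalHJ.AssumptionM1 ν) (hM2 : NonlocalHJ.AssumptionM2 ν)
    (hM3 : NonlocalHJ.AssumptionM3 ν) (hM4 : NonlocalHJ.AssumptionM4 ν)
    (H : NonlocalHJ.Space N → NonlocalHJ.Space N → ℝ) (m : ℝ) (hm : 1 < m)
    (hH0 : NonlocalHJ.AssumptionH0 H) (hH1 : NonlocalHJ.AssumptionH1 H m)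
    (hH2 : NonlocalHJ.AssumptionH2 H m) :
    ∃! u : NonlocalHJ.Space N → ℝ, NonlocalHJ.IsViscositySolution lam ν H u := by
  obtain ⟨u, hu⟩ := NonlocalHJ.exists_isViscositySolution hlam hν hM1 hM2 hM3 hM4 hm hH0 hH1 hH2
  refine ⟨u, hu, fun v hv => funext fun x => le_antisymm ?_ ?_⟩
  · exact NonlocalHJ.comparison hlam hν hM1 hM2 hM3 hM4 hm hH0 hH1 hH2 hv.2.2.1 hu.2.2.2 x
  · exact NonlocalHJ.comparison hlam hν hM1 hM2 hM3 hM4 hm hH0 hH1 hH2 hu.2.2.1 hv.2.2.2 x
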